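/- Let $a_i\in\mathbb{Q}^{\times}$, $b_i\in\mathbb{Q}$ ($1\le i\le 4$), put $f_i(x)=a_ix+b_i$, and let $C$ be the smooth projective genus one curve over $\mathbb{Q}$ with affine equation $$y^2=f_1(x)f_2(x)f_3(x)f_4(x),$$ where smoothness means that the roots $-b_i/a_i$ are pairwise distinct. Let $(x_0,y_0)\in C(\mathbb{Q})$ be an affine point with $x_0\neq -b_i/a_i$ for $i=1,2,3,4$. Let $E$ be an elliptic curve over $\mathbb{Q}$ given by a Weierstrass equation (a model of the Jacobian of $C$) and let $\phi:C\to E$ be a $\mathbb{Q}$-birational isomorphism whose extension to an isomorphism of smooth projective curves satisfies $\phi((x_0,y_0))=O_E$. Give $C(\mathbb{Q})$ the group law $Q_1+Q_2=\phi^{-1}(\phi(Q_1)+\phi(Q_2))$, and let $2C(\mathbb{Q})=\{R+R : R\in C(\mathbb{Q})\}$. Then, for every $Q\in C(\mathbb{Q})$, $$Q\in 2C(\mathbb{Q})\iff f_i(x_0)f_j(x_0)f_i(x(Q))f_j(x(Q))\ \text{is the square of a rational number for all } i,j\in\{1,2,3,4\}.$$ Here, if $Q$ is one of the points at infinity of $C$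 (which are rational exactly when $a_1a_2a_3a_4$ is a square in $\mathbb{Q}$), then $f_i(x(Q))$ is understood as $a_i$. -/

import Mathlib

open Polynomial

noncomputable section

/-- A smooth genus one curve `y² = f₁(x) f₂(x) f₃(x) f₄(x)` over `K` with `fᵢ(x) = aᵢ x + bᵢ`.
Smoothness means that the four roots `-bᵢ / aᵢ` are pairwise distinct, that is, that no two of
the linear forms are proportional. -/
structure SplitQuartic (K : Type*) [Field K] where
  /-- the leading coefficients of the linear factors -/
  a : Fin 4 → K
  /-- the constant coefficients of the linear factors -/
  b : Fin 4 → K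
  a_ne_zero : ∀ i, a i ≠ 0
  smooth : ∀ i j, i ≠ j → a i * b j ≠ a j * b i

/-- For elements `s, t` of a field `F` over `K`, viewed as two coordinate functions on a curve with
function field `F`, and a point with coordinates `(p, q)` on that affine chart, this is the local
ring of the curve at the point: all quotients `n(s, t) / d(s, t)` of polynomial expressions with
`d(p, q) ≠ 0`. -/
def chartLocalRing {K F : Type*} [Field K] [Field F] [Algebra K F] (s t : F) (p q : K) : Set F :=
  {g | ∃ n d : MvPolynomial (Fin 2) K, MvPolynomial.eval ![p, q] d ≠ 0 ∧
    g = MvPolynomial.aeval ![s, t] n / MvPolynomial.aeval ![s, t] d}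

/-- The local ring, inside the function field of a Weierstrass curve, at a rational point.
At the point `O` at infinity the chart has coordinates `x / y` and `1 / y`, and `O` is its
origin. -/
def WeierstrassCurve.Affine.pointLocalRing {K : Type*} [Field K] (W : WeierstrassCurve.Affine K) :
    W.Point → Set W.FunctionField
  | .zero =>
      chartLocalRing
        (algebraMap W.CoordinateRing W.FunctionField (CoordinateRing.mk W (C X)) /
          algebraMap W.CoordinateRing W.FunctionField (CoordinateRing.mk W X))
        (algebraMap W.CoordinateRing W.FunctionField (CoordinateRing.mk W X))⁻¹ (0 : K) 0
  | .some x y _ =>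
      chartLocalRing
        (algebraMap W.CoordinateRing W.FunctionField (CoordinateRing.mk W (C X)))
        (algebraMap W.CoordinateRing W.FunctionField (CoordinateRing.mk W X)) x y

namespace SplitQuartic

variable {K : Type*} [Field K] (C : SplitQuartic K)

/-- The linear form `fᵢ(x) = aᵢ x + bᵢ`. -/
def f (i : Fin 4) (x : K) : K := C.a i * x + C.b i

/-- The `K`-rational points of the smooth projective curve: the solutions of the affine equation,
and the points at infinity. In the coordinates `u = 1 / x`, `v = y / x²` the curve is
`v² = ∏ᵢ (aᵢ + bᵢ u)`, and the points at infinity are the points `(u, v) = (0, α)`. -/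
inductive Point : Type _
  | affine (x y : K) (h : y ^ 2 = ∏ i, C.f i x) : Point
  | infinity (α : K) (h : α ^ 2 = ∏ i, C.a i) : Point

/-- The value `fᵢ(x(Q))`. At a point at infinity it is read off the homogeneous form
`aᵢ X + bᵢ Z` at `(X : Z) = (1 : 0)`, which gives `aᵢ`; products `fᵢ fⱼ`, being of degree two, are
well defined up to nonzero squares in this way. -/
def fAt (i : Fin 4) : C.Point → K
  | .affine x _ _ => C.f i x
  | .infinity _ _ => C.a i

/-- The quartic polynomial on the right hand side. -/
def quartic : K[X] := ∏ i, (Polynomial.C (C.a i) * X + Polynomial.C (C.b i))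

/-- The bivariate polynomial `Y² - f₁(X) f₂(X) f₃(X) f₄(X)`. -/
def polynomial : K[X][X] := X ^ 2 - Polynomial.C C.quartic

/-- The affine coordinate ring `K[x, y] / (y² - f₁(x) f₂(x) f₃(x) f₄(x))`. -/
abbrev CoordinateRing : Type _ := AdjoinRoot C.polynomial

theorem not_sq_eq_quartic (p : K[X]) : p ^ 2 ≠ C.quartic := by
  intro h
  have ha := C.a_ne_zero 0
  have hc : ∀ j, j ≠ 0 → C.a j * (-C.b 0 / C.a 0) + C.b j ≠ 0 := by
    intro j hj h0
    apply C.smooth 0 j hj.symm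
    field_simp at h0
    linear_combination h0
  have h1 := congrArg (Polynomial.eval (-C.b 0 / C.a 0)) h
  have h2 := congrArg (fun q => Polynomial.eval (-C.b 0 / C.a 0) (derivative q)) h
  have h00 : C.a 0 * (-C.b 0 / C.a 0) + C.b 0 = 0 := by field_simp; ring
  simp only [quartic, Fin.prod_univ_four] at h1 h2
  simp only [eval_pow, eval_mul, eval_add, eval_C, eval_X, h00, zero_mul] at h1
  have h3 : p.eval (-C.b 0 / C.a 0) = 0 := by simpa using h1
  simp [derivative_pow, derivative_mul, h3, h00, ha, hc 1, hc 2, hc 3] at h2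

theorem polynomial_monic : C.polynomial.Monic := monic_X_pow_sub_C _ two_ne_zero

theorem polynomial_irreducible : Irreducible C.polynomial := by
  have hd : C.polynomial.natDegree = 2 := natDegree_X_pow_sub_C
  rw [C.polynomial_monic.irreducible_iff_roots_eq_zero_of_degree_le_three (by omega) (by omega)]
  refine Multiset.eq_zero_of_forall_notMem fun p hp => C.not_sq_eq_quartic p ?_
  have := (mem_roots C.polynomial_monic.ne_zero).1 hp
  simpa [polynomial, sub_eq_zero] using this

instance : IsDomain C.CoordinateRing :=
  AdjoinRoot.isDomain_of_prime C.polynomial_irreducible.prime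

/-- The function field `K(C)`. -/
abbrev FunctionField : Type _ := FractionRing C.CoordinateRing

/-- The coordinate function `x` in `K(C)`. -/
def xFun : C.FunctionField :=
  algebraMap C.CoordinateRing C.FunctionField (AdjoinRoot.mk C.polynomial (Polynomial.C X))

/-- The coordinate function `y` in `K(C)`. -/
def yFun : C.FunctionField :=
  algebraMap C.CoordinateRing C.FunctionField (AdjoinRoot.mk C.polynomial X)

/-- The local ring of the curve, inside its function field, at a rational point. -/
def pointLocalRing : C.Point → Set C.FunctionField
  | .affine x y _ => chartLocalRing C.xFun C.yFun x y
  | .infinity α _ => chartLocalRing C.xFun⁻¹ (C.yFun / C.xFun ^ 2) 0 α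

/-- A `K`-birational isomorphism `φ : C → W`, given by its pullback `φ*` on function fields. -/
abbrev BirationalIso (W : WeierstrassCurve.Affine K) : Type _ :=
  W.FunctionField ≃ₐ[K] C.FunctionField

variable {C} {W : WeierstrassCurve.Affine K}

/-- `φ(Q) = P` for the isomorphism of smooth projective curves extending the birational isomorphism
`φ`: the pullback `φ*` identifies the local ring at `P` with the local ring at `Q`. -/
def BirationalIso.MapsTo (φ : C.BirationalIso W) (Q : C.Point) (P : W.Point) : Prop :=
  φ '' W.pointLocalRing P = C.pointLocalRing Q

variable [DecidableEq K]

/-- `S = Q₁ + Q₂` for the group law transported from `W` to the curve by `φ`, that is,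
`φ(S) = φ(Q₁) + φ(Q₂)`. -/
def BirationalIso.IsSum (φ : C.BirationalIso W) (Q₁ Q₂ S : C.Point) : Prop :=
  ∃ P₁ P₂ : W.Point, φ.MapsTo Q₁ P₁ ∧ φ.MapsTo Q₂ P₂ ∧ φ.MapsTo S (P₁ + P₂)

/-- The set `2C(K)` of all `S = R + R` with `R` in `C(K)`, for the group law transported by `φ`. -/
def BirationalIso.doubles (φ : C.BirationalIso W) : Set C.Point :=
  {S | ∃ R : C.Point, φ.IsSum R R S}

end SplitQuartic

end

/-! Points are handled as places, that is, valuation rings of the function field that contain the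
constants. At a rational point of a smooth chart the local ring is such a ring
(`chartLocalRing_eq`), so an isomorphism of function fields transports places, and with them
rational points (`BirationalIso.mapsTo_iff`).

Write $\alpha_i=f_i(x_0)$ and $F_i=f_i(x)$. Each splitting $\{i,j\},\{k,l\}$ of the four forms gives
a descent function $D=(A+B+2y_0y)/(x-x_0)^2$ with $A=\alpha_i\alpha_jF_kF_l$ and
$B=\alpha_k\alpha_lF_iF_j$. Since $AB=y_0^2y^2$, multiplying the numerator by its conjugate gives
$(A-B)^2$, which is divisible by $(x-x_0)^2$. Hence $D$ has no pole at $(x_0,-y_0)$; its only pole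
is a double pole at $(x_0,y_0)$. Carried to $E$, it is a function with only a double pole at $O$, so
it is affine linear in the Weierstrass coordinate (`IsRegular.exists_eq_linear`).

The three descent functions differ by nonzero constants, so they are $c(X-e_1),c(X-e_2),c(X-e_3)$
with the same $c$ and distinct $e_k$. From
$(A+B+2y_0y)\,\alpha_i\alpha_jF_iF_j=(\alpha_i\alpha_jy+y_0F_iF_j)^2$ their product is a square in
the function field (`exists_sq_eq_descentFun_mul`). Comparing with
$(2Y+a_1X+a_3)^2=4X^3+b_2X^2+2b_4X+b_6$, this forces $c$ to be a square and the $e_k$ to be the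
abscissae of the points of order two (`twoDivision_eq_of_sq`).

Classical 2-descent says that $(\xi,\eta)$ is a double exactly when every $\xi-e_k$ is a square
(`exists_add_self_eq_some_iff`). As $c$ is a square, this means that the three descent functions
take square values at $Q$. The displayed identity turns that into squareness of the products
$\alpha_i\alpha_jF_iF_j$; points where a descent function or a form vanishes are settled by using
the other splittings (`isSquare_descent`, `isSquare_of_isSquare_pairs`). -/

noncomputable section

open ValuationSubring

/-! ### Residues of functions at a place. -/

namespace ValuationSubring

variable {K F : Type*} [Field K] [Field F] [Algebra K F] {V : ValuationSubring F}

theorem mul_mem_nonunits {g h : F} (hg : g ∈ V.nonunits) (hh : h ∈ V) : g * h ∈ V.nonunits := by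
  rw [mem_nonunits_iff] at *
  rw [map_mul]
  exact mul_lt_one_of_lt_of_le hg ((V.valuation_le_one_iff h).2 hh)

theorem mem_of_mem_nonunits {g : F} (hg : g ∈ V.nonunits) : g ∈ V := V.nonunits_subset hg

theorem one_notMem_nonunits : (1 : F) ∉ V.nonunits := by
  rw [mem_nonunits_iff, map_one]; exact lt_irrefl _

theorem inv_mem_of_notMem_nonunits {g : F} (hg : g ∉ V.nonunits) : g⁻¹ ∈ V := by
  by_contra h
  exact hg (V.mem_nonunits_iff_or.2 (Or.inr h))

theorem inv_mem_nonunits_of_notMem {g : F} (hg : g ∉ V) : g⁻¹ ∈ V.nonunits :=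
  V.inv_mem_nonunits_iff.2 (Or.inr hg)

theorem mul_notMem_nonunits {g h : F} (hg : g ∉ V.nonunits) (hh : h ∉ V.nonunits) :
    g * h ∉ V.nonunits := by
  rw [mem_nonunits_iff] at *
  rw [map_mul]
  push Not at *
  exact one_le_mul hg hh

theorem mem_of_sq_mem {g : F} (hg : g ^ 2 ∈ V) : g ∈ V := by
  rw [← V.valuation_le_one_iff] at *
  rw [map_pow] at hg
  exact (pow_le_one_iff two_ne_zero).1 hg

theorem mem_or_mem_of_mul_mem_nonunits {g h : F} (hgh : g * h ∈ V.nonunits) :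
    g ∈ V.nonunits ∨ h ∈ V.nonunits := by
  by_contra! hn
  exact mul_notMem_nonunits hn.1 hn.2 hgh

/-- `g` has residue `c ∈ K` at the place `V`, that is, `g ≡ c` modulo the maximal ideal. -/
def IsResidue (V : ValuationSubring F) (g : F) (c : K) : Prop :=
  g - algebraMap K F c ∈ V.nonunits

/-- The place `V` is trivial on the constants `K`. -/
def ContainsConstants (K : Type*) [Field K] [Algebra K F] (V : ValuationSubring F) : Prop :=
  ∀ c : K, algebraMap K F c ∈ V

/-- The place `V` is trivial on `K` and has residue field `K`. -/
structure IsRational (K : Type*) [Field K] [Algebra K F] (V : ValuationSubring F) : Prop where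
  constants : V.ContainsConstants K
  exists_residue : ∀ g ∈ V, ∃ c : K, V.IsResidue g c

theorem ContainsConstants.notMem_nonunits (hV : V.ContainsConstants K) {c : K} (hc : c ≠ 0) :
    algebraMap K F c ∉ V.nonunits := by
  intro h
  have := mul_mem_nonunits h (hV c⁻¹)
  rw [← map_mul, mul_inv_cancel₀ hc, map_one] at this
  exact one_notMem_nonunits this

theorem isResidue_zero_iff {g : F} : V.IsResidue g (0 : K) ↔ g ∈ V.nonunits := by
  simp [IsResidue]

theorem isResidue_algebraMap (c : K) : V.IsResidue (algebraMap K F c) c := by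
  simp only [IsResidue, sub_self]
  exact V.nonunits.zero_mem

namespace IsResidue

variable {g h : F} {c e : K}

theorem mem (hV : V.ContainsConstants K) (hg : V.IsResidue g c) : g ∈ V := by
  have := V.add_mem _ _ (mem_of_mem_nonunits hg) (hV c)
  simpa using this

theorem eq (hV : V.ContainsConstants K) (hg : V.IsResidue g c) (hg' : V.IsResidue g e) :
    c = e := by
  by_contra hne
  refine hV.notMem_nonunits (sub_ne_zero.2 hne) ?_
  have := V.nonunits.sub_mem hg' hg
  rw [map_sub]
  convert this using 1
  ring

theorem mem_nonunits_iff (hV : V.ContainsConstants K) (hg : V.IsResidue g c) :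
    g ∈ V.nonunits ↔ c = 0 := by
  rw [← isResidue_zero_iff (K := K)]
  exact ⟨fun h => hg.eq hV h, fun h => h ▸ hg⟩

theorem add (hg : V.IsResidue g c) (hh : V.IsResidue h e) : V.IsResidue (g + h) (c + e) := by
  have := V.nonunits.add_mem hg hh
  rw [IsResidue, map_add]
  convert this using 1
  ring

theorem neg (hg : V.IsResidue g c) : V.IsResidue (-g) (-c) := by
  have := V.nonunits.neg_mem hg
  rw [IsResidue, map_neg]
  convert this using 1
  ring

theorem sub (hg : V.IsResidue g c) (hh : V.IsResidue h e) : V.IsResidue (g - h) (c - e) := by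
  rw [sub_eq_add_neg, sub_eq_add_neg]
  exact hg.add hh.neg

theorem mul (hV : V.ContainsConstants K) (hg : V.IsResidue g c) (hh : V.IsResidue h e) :
    V.IsResidue (g * h) (c * e) := by
  have := V.nonunits.add_mem (mul_mem_nonunits hg (hh.mem hV)) (mul_mem_nonunits hh (hV c))
  rw [IsResidue, map_mul]
  convert this using 1
  ring

theorem pow (hV : V.ContainsConstants K) (hg : V.IsResidue g c) (n : ℕ) :
    V.IsResidue (g ^ n) (c ^ n) := by
  induction n with
  | zero => simpa using isResidue_algebraMap (V := V) (1 : K)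
  | succ n ih => rw [pow_succ, pow_succ]; exact ih.mul hV hg

theorem inv (hV : V.ContainsConstants K) (hg : V.IsResidue g c) (hc : c ≠ 0) :
    V.IsResidue g⁻¹ c⁻¹ := by
  have h1 : g ∉ V.nonunits := fun h => hc ((hg.mem_nonunits_iff hV).1 h)
  have h0 : g ≠ 0 := by rintro rfl; exact h1 V.nonunits.zero_mem
  have h2 := mul_mem_nonunits (V.nonunits.neg_mem hg)
    (V.mul_mem _ _ (inv_mem_of_notMem_nonunits h1) (hV c⁻¹))
  have hc' : algebraMap K F c ≠ 0 := by simpa using hc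
  rw [IsResidue]
  convert h2 using 1
  rw [map_inv₀]
  field_simp
  ring

theorem div (hV : V.ContainsConstants K) (hg : V.IsResidue g c) (hh : V.IsResidue h e)
    (he : e ≠ 0) : V.IsResidue (g / h) (c / e) := by
  rw [div_eq_mul_inv, div_eq_mul_inv]
  exact hg.mul hV (hh.inv hV he)

theorem mvPolynomial_aeval (hV : V.ContainsConstants K) (hg : V.IsResidue g c)
    (hh : V.IsResidue h e) (n : MvPolynomial (Fin 2) K) :
    V.IsResidue (MvPolynomial.aeval ![g, h] n) (MvPolynomial.eval ![c, e] n) := by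
  induction n using MvPolynomial.induction_on with
  | C a => simpa using isResidue_algebraMap a
  | add p q hp hq => rw [map_add, map_add]; exact hp.add hq
  | mul_X p i hp =>
    rw [map_mul, map_mul]
    refine hp.mul hV ?_
    fin_cases i
    · simpa using hg
    · simpa using hh

theorem polynomial_aeval (hV : V.ContainsConstants K) (hg : V.IsResidue g c) (p : K[X]) :
    V.IsResidue (aeval g p) (p.eval c) := by
  induction p using Polynomial.induction_on' with
  | add p q hp hq => rw [map_add, eval_add]; exact hp.add hq
  | monomial n a =>
    rw [aeval_monomial, eval_monomial]
    exact (isResidue_algebraMap a).mul hV (hg.pow hV n)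

end IsResidue

end ValuationSubring

/-! ### Local rings of smooth charts, and existence of places. -/

section Chart

variable {K F : Type*} [Field K] [Field F] [Algebra K F]

/-- First-order Taylor expansion: the regular functions vanishing at the point are generated by `s -
p` and `t - q`. -/
theorem MvPolynomial.aeval_sub_eval_mem (s t : F) (p q : K) (n : MvPolynomial (Fin 2) K) :
    ∃ a b : MvPolynomial (Fin 2) K,
      aeval ![s, t] n - algebraMap K F (eval ![p, q] n) =
        (s - algebraMap K F p) * aeval ![s, t] a + (t - algebraMap K F q) * aeval ![s, t] b := by
  induction n using MvPolynomial.induction_on with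
  | C a => exact ⟨0, 0, by simp⟩
  | add n m hn hm =>
    obtain ⟨a, b, h⟩ := hn
    obtain ⟨a', b', h'⟩ := hm
    refine ⟨a + a', b + b', ?_⟩
    simp only [map_add]
    linear_combination h + h'
  | mul_X n i hn =>
    obtain ⟨a, b, h⟩ := hn
    fin_cases i
    · refine ⟨a * X 0 + C (eval ![p, q] n), b * X 0, ?_⟩
      simp only [Fin.zero_eta, map_mul, map_add, aeval_X, eval_X, algHom_C, Matrix.cons_val_zero]
      linear_combination s * h
    · refine ⟨a * X 1, b * X 1 + C (eval ![p, q] n), ?_⟩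
      simp only [Fin.mk_one, map_mul, map_add, aeval_X, eval_X, algHom_C, Matrix.cons_val_one,
        Matrix.cons_val_fin_one]
      linear_combination t * h

variable {V : ValuationSubring F} {s t : F} {p q : K}

theorem chartLocalRing_subset (hV : V.ContainsConstants K) (hs : V.IsResidue s p)
    (ht : V.IsResidue t q) : chartLocalRing s t p q ⊆ V := by
  rintro _ ⟨n, d, hd, rfl⟩
  exact ((hs.mvPolynomial_aeval hV ht n).div hV (hs.mvPolynomial_aeval hV ht d) hd).mem hV

/-- If `I` is the ideal of a rational point on an affine curve, locally generated by `π`, then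
every nonzero regular function is locally a power of `π` times a unit. -/
theorem exists_eq_pow_mul_unit {A : Type*} [CommRing A] [IsDomain A] [IsNoetherianRing A]
    {I : Ideal A} [hI : I.IsMaximal] {π : A} (hπ : π ∈ I)
    (hgen : ∀ a ∈ I, ∃ d ∉ I, ∃ b, d * a = π * b) {a : A} (ha : a ≠ 0) :
    ∃ (k : ℕ) (e b : A), e ∉ I ∧ b ∉ I ∧ e * a = π ^ k * b := by
  have hP := hI.isPrime
  have key : ∀ (k : ℕ) (a : A), a ∉ I ^ k →
      ∃ (j : ℕ) (e b : A), e ∉ I ∧ b ∉ I ∧ e * a = π ^ j * b := by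
    intro k
    induction k with
    | zero => intro a ha; simp at ha
    | succ k ih =>
      intro a ha
      by_cases haI : a ∈ I
      · obtain ⟨d, hd, b, hdb⟩ := hgen a haI
        -- `d` is invertible modulo every power of the maximal ideal `I`, so `d * a ∈ I ^ (k + 1)`
        -- would put `a` itself there.
        have hb : b ∉ I ^ k := by
          intro hb
          have h1 : d * a ∈ I ^ (k + 1) := by
            rw [hdb, pow_succ']; exact Ideal.mul_mem_mul hπ hb
          obtain ⟨y, i, hi, hyi⟩ := hI.exists_inv hd
          obtain ⟨c, z, hcz⟩ : IsCoprime d (i ^ (k + 1)) :=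
            IsCoprime.pow_right ⟨y, 1, by rw [one_mul, hyi]⟩
          apply ha
          have : a = c * (d * a) + z * i ^ (k + 1) * a := by linear_combination -a * hcz
          rw [this]
          exact add_mem (Ideal.mul_mem_left _ _ h1)
            (Ideal.mul_mem_right _ _ (Ideal.mul_mem_left _ _ (Ideal.pow_mem_pow hi _)))
        obtain ⟨j, e, b', he, hb', h⟩ := ih b hb
        refine ⟨j + 1, e * d, b', hP.mul_notMem he hd, hb', ?_⟩
        linear_combination e * hdb + π * h
      · exact ⟨0, 1, a, fun h => hP.ne_top ((Ideal.eq_top_iff_one _).2 h), haI, by simp⟩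
  -- Krull's intersection theorem: a nonzero element cannot lie in all powers of `I`.
  have : ∃ k, a ∉ I ^ k := by
    by_contra! h
    have h2 : a ∈ ⨅ k, I ^ k := by simpa using h
    rw [Ideal.iInf_pow_eq_bot_of_isDomain I hP.ne_top] at h2
    exact ha (by simpa using h2)
  obtain ⟨k, hk⟩ := this
  exact key k a hk

/-- A smooth chart computes the local ring of the place at its centre. -/
theorem chartLocalRing_eq (hV : V.ContainsConstants K) (hs : V.IsResidue s p)
    (ht : V.IsResidue t q) (hF : IntermediateField.adjoin K (Set.range ![s, t]) = ⊤)
    {α β : MvPolynomial (Fin 2) K}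
    (hrel : MvPolynomial.aeval ![s, t] α * (t - algebraMap K F q) =
      MvPolynomial.aeval ![s, t] β * (s - algebraMap K F p))
    (hsm : MvPolynomial.eval ![p, q] α ≠ 0 ∨ MvPolynomial.eval ![p, q] β ≠ 0) :
    chartLocalRing s t p q = V := by
  refine (chartLocalRing_subset hV hs ht).antisymm fun g hg => ?_
  set ev := MvPolynomial.aeval (R := K) ![s, t] with hev
  have hres := fun n => hs.mvPolynomial_aeval hV ht n
  let A := ev.range
  have : IsNoetherianRing A :=
    isNoetherianRing_of_surjective _ _ ev.rangeRestrict.toRingHom ev.rangeRestrict_surjective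
  let r := fun n => ev.rangeRestrict n
  have hr : ∀ a : A, ∃ n, r n = a := ev.rangeRestrict_surjective
  let I : Ideal A :=
    { carrier := {a | (a : F) ∈ V.nonunits}
      add_mem' := fun ha hb => V.nonunits.add_mem ha hb
      zero_mem' := V.nonunits.zero_mem
      smul_mem' := by
        intro c a ha
        obtain ⟨n, rfl⟩ := hr c
        have := mul_mem_nonunits (V := V) ha ((hres n).mem hV)
        rwa [mul_comm] at this }
  have hI : ∀ n, r n ∈ I ↔ MvPolynomial.eval ![p, q] n = 0 := fun n =>
    (hres n).mem_nonunits_iff hV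
  have hImax : I.IsMaximal := by
    rw [Ideal.isMaximal_iff]
    refine ⟨one_notMem_nonunits, fun J a hIJ ha haJ => ?_⟩
    obtain ⟨n, rfl⟩ := hr a
    have hn := mt (hI n).2 ha
    set c := MvPolynomial.eval ![p, q] n with hc
    have h1 : r (n - MvPolynomial.C c) ∈ J := hIJ ((hI _).2 (by simp [hc]))
    have h2 : r (MvPolynomial.C c⁻¹) * (r n - r (n - MvPolynomial.C c)) ∈ J :=
      J.mul_mem_left _ (J.sub_mem haJ h1)
    convert h2 using 1
    simp only [r, map_sub, sub_sub_cancel]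
    rw [← map_mul, ← map_mul, inv_mul_cancel₀ hn, map_one, map_one]
  -- By smoothness one coordinate difference generates the ideal of the point locally: `s - p` if
  -- `α` is nonzero there, `t - q` if `β` is.
  obtain ⟨π, d, a, b, hπ, hd, ha, hb⟩ : ∃ π d a b : MvPolynomial (Fin 2) K,
      MvPolynomial.eval ![p, q] π = 0 ∧ MvPolynomial.eval ![p, q] d ≠ 0 ∧
      ev d * (s - algebraMap K F p) = ev π * ev a ∧
      ev d * (t - algebraMap K F q) = ev π * ev b := by
    rw [hev] at hrel ⊢
    rcases hsm with h | h
    · refine ⟨.X 0 - .C p, α, α, β, by simp, h, ?_, ?_⟩ <;> simp <;>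
        first | ring1 | linear_combination hrel
    · refine ⟨.X 1 - .C q, β, α, β, by simp, h, ?_, ?_⟩ <;> simp <;>
        first | ring1 | linear_combination -hrel
  have hgen : ∀ x ∈ I, ∃ e ∉ I, ∃ y, e * x = r π * y := by
    intro x hx
    obtain ⟨n, rfl⟩ := hr x
    obtain ⟨n₁, n₂, hn⟩ := MvPolynomial.aeval_sub_eval_mem s t p q n
    rw [(hI n).1 hx, map_zero, sub_zero] at hn
    refine ⟨r d, mt (hI d).1 hd, r (a * n₁ + b * n₂), Subtype.ext ?_⟩
    change ev d * ev n = ev π * ev (a * n₁ + b * n₂)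
    rw [map_add, map_mul, map_mul, hn]
    linear_combination ev n₁ * ha + ev n₂ * hb
  have hadj : g ∈ IntermediateField.adjoin K (Set.range ![s, t]) := by rw [hF]; trivial
  obtain ⟨N, D, rfl⟩ := (IntermediateField.mem_adjoin_range_iff K _ g).1 hadj
  rw [← hev] at hg ⊢
  by_cases hN : r N = 0
  · have : ev N = 0 := congrArg Subtype.val hN
    exact ⟨0, 1, by simp, by simp [this]⟩
  by_cases hD : r D = 0
  · have : ev D = 0 := congrArg Subtype.val hD
    exact ⟨0, 1, by simp, by simp [this]⟩
  obtain ⟨i, e₁, b₁, he₁, hb₁, h₁⟩ := exists_eq_pow_mul_unit ((hI π).2 hπ) hgen hN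
  obtain ⟨j, e₂, b₂, he₂, hb₂, h₂⟩ := exists_eq_pow_mul_unit ((hI π).2 hπ) hgen hD
  obtain ⟨e₁, rfl⟩ := hr e₁
  obtain ⟨e₂, rfl⟩ := hr e₂
  obtain ⟨b₁, rfl⟩ := hr b₁
  obtain ⟨b₂, rfl⟩ := hr b₂
  have hne : ∀ {n}, r n ∉ I → ev n ≠ 0 := fun {n} h h0 => h (by
    rw [show r n = 0 from Subtype.ext h0]; exact I.zero_mem)
  have hN' : ev N ≠ 0 := fun h => hN (Subtype.ext h)
  have hD' : ev D ≠ 0 := fun h => hD (Subtype.ext h)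
  replace h₁ : ev e₁ * ev N = ev π ^ i * ev b₁ := congrArg Subtype.val h₁
  replace h₂ : ev e₂ * ev D = ev π ^ j * ev b₂ := congrArg Subtype.val h₂
  -- Up to units the quotient is `π ^ (i - j)`. A negative exponent is impossible for an element of
  -- `V`, since multiplying it by a positive power of `π` would make a unit vanish at the point.
  have hπ0 : ev N / ev D * (ev π ^ j * (ev b₂ * ev e₁)) = ev π ^ i * (ev b₁ * ev e₂) := by
    field_simp
    linear_combination -ev N * ev e₁ * h₂ + ev e₂ * ev D * h₁
  have hunit : ∀ {n}, r n ∉ I → MvPolynomial.eval ![p, q] n ≠ 0 := fun h h0 => h ((hI _).2 h0)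
  rcases le_or_gt j i with hij | hij
  · obtain ⟨k, rfl⟩ := Nat.exists_eq_add_of_le hij
    refine ⟨π ^ k * (b₁ * e₂), b₂ * e₁, ?_, ?_⟩
    · rw [map_mul]
      exact mul_ne_zero (hunit hb₂) (hunit he₁)
    · rcases eq_or_ne (ev π ^ j) 0 with h0 | h0
      · rw [h0, zero_mul] at h₂
        exact absurd h₂ (mul_ne_zero (hne he₂) hD')
      · rw [← hev]
        simp only [map_mul, map_pow]
        rw [eq_div_iff (mul_ne_zero (hne hb₂) (hne he₁))]
        apply mul_left_cancel₀ h0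
        linear_combination hπ0
  · obtain ⟨k, rfl⟩ := Nat.exists_eq_add_of_lt hij
    exfalso
    rcases eq_or_ne (ev π ^ i) 0 with h0 | h0
    · rw [h0, zero_mul] at h₁
      exact mul_ne_zero (hne he₁) hN' h₁
    have h3 : ev b₁ * ev e₂ = ev N / ev D * ev (π ^ (k + 1) * (b₂ * e₁)) := by
      simp only [map_mul, map_pow]
      apply mul_left_cancel₀ h0
      linear_combination -hπ0
    have h4 : r (b₁ * e₂) ∈ I := by
      change ev (b₁ * e₂) ∈ V.nonunits
      rw [map_mul, h3, mul_comm]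
      refine mul_mem_nonunits (((hres _).mem_nonunits_iff hV).2 ?_) hg
      simp [hπ]
    rw [hI, map_mul] at h4
    exact mul_ne_zero (hunit hb₁) (hunit he₂) h4

theorem isRational_of_chart (hV : V.ContainsConstants K) (hs : V.IsResidue s p)
    (ht : V.IsResidue t q) (h : chartLocalRing s t p q = V) : V.IsRational K := by
  refine ⟨hV, fun g hg => ?_⟩
  obtain ⟨n, d, hd, rfl⟩ : g ∈ chartLocalRing s t p q := h ▸ hg
  exact ⟨_, (hs.mvPolynomial_aeval hV ht n).div hV (hs.mvPolynomial_aeval hV ht d) hd⟩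

/-- Every prime ideal of a domain over `K` is the centre of some place of a field containing it. -/
theorem exists_place_of_ideal {A : Type*} [CommRing A] [Algebra K A] (f : A →ₐ[K] F)
    (hf : Function.Injective f) {I : Ideal A} (hI : I ≠ ⊤) :
    ∃ V : ValuationSubring F, V.ContainsConstants K ∧ (∀ a, f a ∈ V) ∧
      ∀ a ∈ I, f a ∈ V.nonunits := by
  let e : A ≃+* (f : A →+* F).range := RingEquiv.ofBijective (f : A →+* F).rangeRestrict
    ⟨fun a b hab => hf (congrArg Subtype.val hab), (f : A →+* F).rangeRestrict_surjective⟩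
  have hJ : I.map (e : A →+* (f : A →+* F).range) ≠ ⊤ := by
    intro h
    apply hI
    rw [← Ideal.comap_map_of_bijective (e : A →+* (f : A →+* F).range) e.bijective (I := I), h,
      Ideal.comap_top]
  obtain ⟨V, h1, h2⟩ := Ideal.image_subset_nonunits_valuationSubring _ hJ
  refine ⟨V, fun c => h1 ⟨algebraMap K A c, f.commutes c⟩, fun a => h1 ⟨a, rfl⟩, fun a ha => h2 ⟨e a, ?_, rfl⟩⟩
  exact Ideal.mem_map_of_mem (e : A →+* (f : A →+* F).range) ha

theorem exists_place_of_transcendental {w : F} (hw : Transcendental K w) :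
    ∃ V : ValuationSubring F, V.ContainsConstants K ∧ w ∈ V.nonunits := by
  obtain ⟨V, hV, -, h⟩ := exists_place_of_ideal (aeval (R := K) w)
    (transcendental_iff_injective.1 hw) (I := Ideal.span {X}) (by
      rw [Ne, Ideal.span_singleton_eq_top]; exact not_isUnit_X)
  refine ⟨V, hV, ?_⟩
  simpa using h X (Ideal.mem_span_singleton_self X)

end Chart

/-! ### Pulling back places; curves `t² = G(s)`. -/

section Comap

variable {K F F' : Type*} [Field K] [Field F] [Field F'] [Algebra K F] [Algebra K F']

theorem ValuationSubring.mem_nonunits_comap (V : ValuationSubring F') (f : F →+* F') {g : F} :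
    g ∈ (V.comap f).nonunits ↔ f g ∈ V.nonunits := by
  rw [mem_nonunits_iff_or, mem_nonunits_iff_or, mem_comap, map_inv₀, map_eq_zero]

theorem ValuationSubring.isResidue_comap (V : ValuationSubring F') (f : F →ₐ[K] F') {g : F}
    {c : K} : (V.comap (f : F →+* F')).IsResidue g c ↔ V.IsResidue (f g) c := by
  rw [IsResidue, mem_nonunits_comap, IsResidue]
  simp

theorem ValuationSubring.ContainsConstants.comap {V : ValuationSubring F'}
    (hV : V.ContainsConstants K) (f : F →ₐ[K] F') :
    (V.comap (f : F →+* F')).ContainsConstants K := fun c => by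
  rw [mem_comap]
  simpa using hV c

theorem IntermediateField.adjoin_pair_eq_top {x y s t : F}
    (h : IntermediateField.adjoin K (Set.range ![x, y]) = ⊤)
    (hx : x ∈ IntermediateField.adjoin K (Set.range ![s, t]))
    (hy : y ∈ IntermediateField.adjoin K (Set.range ![s, t])) :
    IntermediateField.adjoin K (Set.range ![s, t]) = ⊤ := by
  rw [_root_.eq_top_iff, ← h, IntermediateField.adjoin_le_iff]
  rintro _ ⟨i, rfl⟩
  fin_cases i
  · exact hx
  · exact hy

theorem IntermediateField.left_mem_adjoin_range (s t : F) :
    s ∈ IntermediateField.adjoin K (Set.range ![s, t]) :=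
  IntermediateField.subset_adjoin _ _ ⟨0, rfl⟩

theorem IntermediateField.right_mem_adjoin_range (s t : F) :
    t ∈ IntermediateField.adjoin K (Set.range ![s, t]) :=
  IntermediateField.subset_adjoin _ _ ⟨1, rfl⟩

theorem Polynomial.mvAeval_aeval_X_zero {E : Type*} [CommRing E] [Algebra K E] (a b : E)
    (H : K[X]) : MvPolynomial.aeval ![a, b] (Polynomial.aeval (MvPolynomial.X 0 : MvPolynomial (Fin 2) K) H) =
      Polynomial.aeval a H := by
  rw [← aeval_algHom_apply, MvPolynomial.aeval_X, Matrix.cons_val_zero]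

/-- The smooth chart of a curve `t² = G(s)`. -/
theorem chartLocalRing_eq_of_sq (h2 : (2 : K) ≠ 0) {V : ValuationSubring F}
    (hV : V.ContainsConstants K) {s t : F} {p q : K} (hs : V.IsResidue s p)
    (ht : V.IsResidue t q) (hF : IntermediateField.adjoin K (Set.range ![s, t]) = ⊤)
    {G : K[X]} (hst : t ^ 2 = aeval s G) (hpq : q ^ 2 = G.eval p)
    (hsm : q ≠ 0 ∨ G.derivative.eval p ≠ 0) : chartLocalRing s t p q = V := by
  obtain ⟨H, hH⟩ : X - C p ∣ G - C (G.eval p) := by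
    rw [dvd_iff_isRoot]; simp
  have hH' : aeval s G - algebraMap K F (G.eval p) = (s - algebraMap K F p) * aeval s H := by
    simpa using congrArg (aeval s) hH
  have hHp : H.eval p = G.derivative.eval p := by
    have := congrArg (fun P => P.derivative.eval p) hH
    simpa using this.symm
  -- The relation is `(t + q) (t - q) = H(s) (s - p)`, where `H` is the difference quotient of `G`
  -- at `p`, with `H(p) = G'(p)`.
  refine chartLocalRing_eq hV hs ht hF (α := .X 1 + .C q) (β := aeval (.X 0) H) ?_ ?_
  · rw [Polynomial.mvAeval_aeval_X_zero]
    simp only [map_add, MvPolynomial.aeval_X, Matrix.cons_val_one, Matrix.cons_val_fin_one,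
      MvPolynomial.algHom_C]
    rw [← hpq, map_pow] at hH'
    linear_combination hst + hH'
  · refine hsm.imp (fun h => ?_) (fun h => ?_)
    · simpa [← two_mul] using ⟨h2, h⟩
    · have := Polynomial.mvAeval_aeval_X_zero p q H
      rw [MvPolynomial.aeval_eq_eval] at this
      change MvPolynomial.eval _ _ ≠ 0
      rw [this]
      simpa [hHp] using h

end Comap

/-! ### Places of the quartic curve and its rational points. -/

namespace SplitQuartic

variable {K : Type*} [Field K] (C : SplitQuartic K)

theorem eval_quartic (p : K) : C.quartic.eval p = ∏ i, C.f i p := by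
  simp [quartic, f, eval_prod]

/-- The linear form `fᵢ` as a function on the curve. -/
def fFun (i : Fin 4) : C.FunctionField :=
  algebraMap K _ (C.a i) * C.xFun + algebraMap K _ (C.b i)

theorem xFun_eq_algebraMap : C.xFun = algebraMap K[X] C.FunctionField X := by
  rw [IsScalarTower.algebraMap_apply K[X] C.CoordinateRing C.FunctionField]
  rfl

theorem aeval_xFun (P : K[X]) : aeval C.xFun P = algebraMap K[X] C.FunctionField P := by
  rw [xFun_eq_algebraMap, aeval_algebraMap_apply, aeval_X_left_apply]

theorem algebraMap_injective : Function.Injective (algebraMap K[X] C.FunctionField) := by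
  rw [IsScalarTower.algebraMap_eq K[X] C.CoordinateRing C.FunctionField]
  refine (IsFractionRing.injective C.CoordinateRing C.FunctionField).comp ?_
  refine AdjoinRoot.of.injective_of_degree_ne_zero ?_
  rw [polynomial, degree_X_pow_sub_C two_pos]
  decide

theorem transcendental_xFun : Transcendental K C.xFun := by
  rw [transcendental_iff_injective]
  intro P Q h
  exact C.algebraMap_injective (by simpa only [aeval_xFun] using h)

theorem yFun_sq : C.yFun ^ 2 = aeval C.xFun C.quartic := by
  rw [aeval_xFun, IsScalarTower.algebraMap_apply K[X] C.CoordinateRing C.FunctionField, yFun,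
    ← map_pow, ← map_pow]
  congr 1
  rw [← sub_eq_zero]
  change AdjoinRoot.mk _ _ - AdjoinRoot.mk _ (Polynomial.C _) = 0
  rw [← map_sub]
  exact AdjoinRoot.mk_self

theorem yFun_sq' : C.yFun ^ 2 = ∏ i, C.fFun i := by
  rw [yFun_sq, quartic, map_prod]
  simp [fFun]

theorem xFun_sub_ne_zero (p : K) : C.xFun - algebraMap K _ p ≠ 0 := by
  intro h
  exact C.transcendental_xFun (by rw [sub_eq_zero.1 h]; exact isAlgebraic_algebraMap p)

theorem xFun_ne_zero : C.xFun ≠ 0 := by simpa using C.xFun_sub_ne_zero 0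

theorem fFun_ne_zero (i : Fin 4) : C.fFun i ≠ 0 := by
  intro h
  have ha : algebraMap K C.FunctionField (C.a i) ≠ 0 := by simpa using C.a_ne_zero i
  apply C.xFun_sub_ne_zero (-C.b i / C.a i)
  rw [map_div₀, map_neg]
  rw [fFun] at h
  field_simp
  linear_combination h

theorem yFun_ne_zero : C.yFun ≠ 0 := by
  have := C.yFun_sq'
  intro h
  rw [h, zero_pow two_ne_zero] at this
  exact Finset.prod_ne_zero_iff.2 (fun i _ => C.fFun_ne_zero i) this.symm

theorem adjoin_xFun_yFun :
    IntermediateField.adjoin K (Set.range ![C.xFun, C.yFun]) = ⊤ := by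
  rw [_root_.eq_top_iff]
  rintro g -
  have key : ∀ a : C.CoordinateRing, algebraMap _ C.FunctionField a ∈
      IntermediateField.adjoin K (Set.range ![C.xFun, C.yFun]) := by
    intro a
    obtain ⟨P, rfl⟩ := AdjoinRoot.mk_surjective a
    induction P using Polynomial.induction_on' with
    | add P Q hP hQ => rw [map_add, map_add]; exact add_mem hP hQ
    | monomial n a =>
      rw [← C_mul_X_pow_eq_monomial, map_mul, map_mul, map_pow, map_pow]
      refine mul_mem ?_ (pow_mem (IntermediateField.right_mem_adjoin_range _ _) n)
      have : algebraMap C.CoordinateRing C.FunctionField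
          (AdjoinRoot.mk C.polynomial (Polynomial.C a)) = aeval C.xFun a := by
        rw [aeval_xFun, IsScalarTower.algebraMap_apply K[X] C.CoordinateRing C.FunctionField]
        rfl
      rw [this]
      exact Algebra.adjoin_le (S := (IntermediateField.adjoin K
        (Set.range ![C.xFun, C.yFun])).toSubalgebra) (Set.singleton_subset_iff.2
        (IntermediateField.left_mem_adjoin_range (K := K) C.xFun C.yFun))
        (aeval_mem_adjoin_singleton K C.xFun)
  obtain ⟨a, b, -, rfl⟩ := IsFractionRing.div_surjective (A := C.CoordinateRing) g
  exact div_mem (key a) (key b)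

/-- The hyperelliptic involution `(x, y) ↦ (x, -y)` of the function field. -/
theorem exists_involution : ∃ σ : C.FunctionField →ₐ[K] C.FunctionField,
    σ C.xFun = C.xFun ∧ σ C.yFun = -C.yFun := by
  have hroot : C.polynomial.eval₂ (Algebra.ofId K[X] C.CoordinateRing).toRingHom
      (-AdjoinRoot.root C.polynomial) = 0 := by
    have h1 : ∀ z : C.CoordinateRing, C.polynomial.eval₂ (algebraMap K[X] C.CoordinateRing) z =
        z ^ 2 - algebraMap K[X] C.CoordinateRing C.quartic := fun z => by
      change (X ^ 2 - Polynomial.C C.quartic : K[X][X]).eval₂ _ z = _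
      rw [eval₂_sub, eval₂_pow, eval₂_X, eval₂_C]
    have h2 := (h1 (AdjoinRoot.root C.polynomial)).symm.trans (AdjoinRoot.eval₂_root C.polynomial)
    exact (h1 _).trans (by rw [neg_sq]; exact h2)
  let τ : C.CoordinateRing →ₐ[K[X]] C.CoordinateRing :=
    AdjoinRoot.liftAlgHom C.polynomial (Algebra.ofId _ _) (-AdjoinRoot.root _) hroot
  have hτ : τ (AdjoinRoot.root _) = -AdjoinRoot.root _ := AdjoinRoot.lift_root hroot
  have hττ : τ.comp τ = AlgHom.id _ _ := by
    apply AdjoinRoot.algHom_ext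
    simp [hτ]
  have hinj : Function.Injective τ := by
    apply Function.LeftInverse.injective (g := τ)
    intro a
    exact DFunLike.congr_fun hττ a
  let j : C.CoordinateRing →ₐ[K] C.FunctionField :=
    (IsScalarTower.toAlgHom K C.CoordinateRing C.FunctionField).comp (τ.restrictScalars K)
  have hj : Function.Injective j :=
    (IsFractionRing.injective C.CoordinateRing C.FunctionField).comp hinj
  refine ⟨IsFractionRing.liftAlgHom hj, ?_, ?_⟩
  · rw [xFun, IsFractionRing.liftAlgHom_apply, IsFractionRing.lift_algebraMap]
    change algebraMap _ _ (τ (algebraMap K[X] _ X)) = algebraMap _ _ (algebraMap K[X] _ X)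
    rw [τ.commutes]
  · rw [yFun, IsFractionRing.liftAlgHom_apply, IsFractionRing.lift_algebraMap]
    change algebraMap _ _ (τ (AdjoinRoot.root _)) = -algebraMap _ _ (AdjoinRoot.root _)
    rw [hτ, map_neg]

variable {C}

/-- The place `V` of the function field is centred at the point `Q`. -/
def IsCentredAt (V : ValuationSubring C.FunctionField) : C.Point → Prop
  | .affine x y _ => V.IsResidue C.xFun x ∧ V.IsResidue C.yFun y
  | .infinity α _ => V.IsResidue C.xFun⁻¹ (0 : K) ∧ V.IsResidue (C.yFun / C.xFun ^ 2) α

variable (C) in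
/-- The quartic in the coordinate `1 / x`. -/
def reverseQuartic : K[X] :=
  ∏ i, (Polynomial.C (C.b i) * X + Polynomial.C (C.a i))

variable (C) in
theorem yFun_div_sq : (C.yFun / C.xFun ^ 2) ^ 2 = aeval C.xFun⁻¹ C.reverseQuartic := by
  have hx := C.xFun_ne_zero
  rw [div_pow, yFun_sq', reverseQuartic, map_prod]
  simp only [map_add, map_mul, aeval_C, aeval_X, Fin.prod_univ_four, fFun]
  field_simp
  ring

variable {V : ValuationSubring C.FunctionField}

/-- The roots of the quartic are simple, so at a point with `y = 0` the chart is smooth with local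
parameter `y`. -/
theorem prod_f_derivative_ne_zero {p : K} (h : ∏ i, C.f i p = 0) :
    C.quartic.derivative.eval p ≠ 0 := by
  obtain ⟨i, -, hi⟩ := Finset.prod_eq_zero_iff.1 h
  have hne : ∀ j, j ≠ i → C.f j p ≠ 0 := by
    intro j hj h0
    apply C.smooth i j hj.symm
    unfold f at hi h0
    linear_combination C.a i * h0 - C.a j * hi
  have ha := C.a_ne_zero i
  unfold f at hi hne
  simp only [quartic, Fin.prod_univ_four, derivative_mul, derivative_add, derivative_C,
    derivative_X, eval_add, eval_mul, eval_C, eval_X, eval_zero, eval_one]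
  fin_cases i
  · simp only [Fin.zero_eta] at hi ha hne
    simp [hi, ha, hne]
  · simp only [Fin.mk_one] at hi ha hne
    simp [hi, ha, hne]
  · simp only [Fin.reduceFinMk] at hi ha hne
    simp [hi, ha, hne]
  · simp only [Fin.reduceFinMk] at hi ha hne
    simp [hi, ha, hne]

theorem IsCentredAt.pointLocalRing_eq (h2 : (2 : K) ≠ 0) (hV : V.ContainsConstants K)
    {Q : C.Point} (h : IsCentredAt V Q) : C.pointLocalRing Q = V := by
  cases Q with
  | affine x y hxy =>
    refine chartLocalRing_eq_of_sq h2 hV h.1 h.2 C.adjoin_xFun_yFun C.yFun_sq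
      (by rw [hxy, eval_quartic]) ?_
    by_cases hy : y = 0
    · right
      apply prod_f_derivative_ne_zero
      rw [← hxy, hy]; simp
    · exact Or.inl hy
  | infinity α hα =>
    have hx := C.xFun_ne_zero
    refine chartLocalRing_eq_of_sq h2 hV h.1 h.2 ?_ C.yFun_div_sq
      (by rw [hα, reverseQuartic, eval_prod]; simp) ?_
    · have h1 := IntermediateField.left_mem_adjoin_range (K := K) C.xFun⁻¹ (C.yFun / C.xFun ^ 2)
      have h2 := IntermediateField.right_mem_adjoin_range (K := K) C.xFun⁻¹ (C.yFun / C.xFun ^ 2)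
      have h3 := inv_mem h1
      rw [inv_inv] at h3
      refine IntermediateField.adjoin_pair_eq_top C.adjoin_xFun_yFun h3 ?_
      have := mul_mem h2 (pow_mem h3 2)
      rwa [div_mul_cancel₀ _ (pow_ne_zero 2 hx)] at this
    · left
      rintro rfl
      rw [zero_pow two_ne_zero] at hα
      exact Finset.prod_ne_zero_iff.2 (fun i _ => C.a_ne_zero i) hα.symm

theorem IsCentredAt.isRational (h2 : (2 : K) ≠ 0) (hV : V.ContainsConstants K)
    {Q : C.Point} (h : IsCentredAt V Q) : V.IsRational K := by
  have := h.pointLocalRing_eq h2 hV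
  cases Q with
  | affine x y hxy => exact isRational_of_chart hV h.1 h.2 this
  | infinity α hα => exact isRational_of_chart hV h.1 h.2 this

/-- Over `s = p` some place exists, and there `t² ≡ q²` gives `t ≡ q` or `t ≡ -q`. In the second
case the involution moves the place to the required point. -/
theorem exists_place_of_sq {s t : C.FunctionField} {p q : K}
    (hs : Transcendental K (s - algebraMap K _ p)) {G : K[X]} (hst : t ^ 2 = aeval s G)
    (hpq : q ^ 2 = G.eval p) {σ : C.FunctionField →ₐ[K] C.FunctionField} (hσs : σ s = s)
    (hσt : σ t = -t) : ∃ V : ValuationSubring C.FunctionField, V.ContainsConstants K ∧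
      V.IsResidue s p ∧ V.IsResidue t q := by
  obtain ⟨V, hV, h : V.IsResidue s p⟩ := exists_place_of_transcendental hs
  have h1 := h.polynomial_aeval hV G
  rw [← hst, ← hpq] at h1
  have h3 : (t - algebraMap K _ q) * (-t - algebraMap K _ q) ∈ V.nonunits := by
    have := V.nonunits.neg_mem h1
    rw [map_pow] at this
    convert this using 1
    ring
  rcases mem_or_mem_of_mul_mem_nonunits h3 with h4 | h4
  · exact ⟨V, hV, h, h4⟩
  · refine ⟨V.comap (σ : C.FunctionField →+* C.FunctionField), hV.comap σ, ?_, ?_⟩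
    · rwa [isResidue_comap, hσs]
    · rwa [isResidue_comap, hσt]

theorem exists_isCentredAt (Q : C.Point) : ∃ V : ValuationSubring C.FunctionField,
    V.ContainsConstants K ∧ IsCentredAt V Q := by
  obtain ⟨σ, hσx, hσy⟩ := C.exists_involution
  cases Q with
  | affine x y hxy =>
    refine exists_place_of_sq (fun h => C.transcendental_xFun ?_) C.yFun_sq
      (by rw [hxy, eval_quartic]) hσx hσy
    simpa using h.add (isAlgebraic_algebraMap (A := C.FunctionField) x)
  | infinity α hα =>
    refine exists_place_of_sq (fun h => C.transcendental_xFun ?_) C.yFun_div_sq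
      (by rw [hα, reverseQuartic, eval_prod]; simp) (σ := σ) ?_ ?_
    · simpa using (show IsAlgebraic K C.xFun⁻¹ by simpa using h).inv
    · rw [map_inv₀, hσx]
    · rw [map_div₀, map_pow, hσx, hσy, neg_div]

/-- Either `x` is finite at the place or `1 / x` vanishes there. In the corresponding chart the
square of the second coordinate is a polynomial in the first, so that coordinate is finite too, and
the residues are the coordinates of the point. -/
theorem exists_point_of_isRational (hV : V.IsRational K) : ∃ Q : C.Point, IsCentredAt V Q := by
  have hK := hV.constants
  by_cases hx : C.xFun ∈ V
  · obtain ⟨p, hp⟩ := hV.exists_residue _ hx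
    have h1 := hp.polynomial_aeval hK C.quartic
    rw [← yFun_sq] at h1
    obtain ⟨q, hq⟩ := hV.exists_residue _ (mem_of_sq_mem (h1.mem hK))
    have h3 := (hq.pow hK 2).eq hK h1
    rw [eval_quartic] at h3
    exact ⟨.affine p q h3, hp, hq⟩
  · have hp : V.IsResidue C.xFun⁻¹ (0 : K) :=
      isResidue_zero_iff.2 (inv_mem_nonunits_of_notMem hx)
    have h1 := hp.polynomial_aeval hK C.reverseQuartic
    rw [← yFun_div_sq] at h1
    obtain ⟨q, hq⟩ := hV.exists_residue _ (mem_of_sq_mem (h1.mem hK))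
    have h3 := (hq.pow hK 2).eq hK h1
    exact ⟨.infinity q (by rw [h3, reverseQuartic, eval_prod]; simp), hp, hq⟩

theorem not_isResidue_inv_zero {F : Type*} [Field F] [Algebra K F] {V : ValuationSubring F}
    {g : F} (hg0 : g ≠ 0) (hg : g ∈ V) : ¬ V.IsResidue g⁻¹ (0 : K) := by
  rw [isResidue_zero_iff, inv_mem_nonunits_iff]
  tauto

theorem IsCentredAt.unique (hV : V.ContainsConstants K) {Q Q' : C.Point} (h : IsCentredAt V Q)
    (h' : IsCentredAt V Q') : Q = Q' := by
  cases Q with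
  | affine x y hxy =>
    cases Q' with
    | affine x' y' hxy' =>
      obtain rfl := h.1.eq hV h'.1
      obtain rfl := h.2.eq hV h'.2
      rfl
    | infinity α hα => exact absurd h'.1 (not_isResidue_inv_zero C.xFun_ne_zero (h.1.mem hV))
  | infinity α hα =>
    cases Q' with
    | affine x' y' hxy' =>
      exact absurd h.1 (not_isResidue_inv_zero C.xFun_ne_zero (h'.1.mem hV))
    | infinity α' hα' =>
      obtain rfl := h.2.eq hV h'.2
      rfl

end SplitQuartic

/-! ### Places of the Weierstrass curve and its rational points. -/

namespace WeierstrassCurve.Affine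

variable {K : Type*} [Field K] (W : WeierstrassCurve.Affine K)

/-- The coordinate function `x` of a Weierstrass curve. -/
def xFun : W.FunctionField :=
  algebraMap W.CoordinateRing W.FunctionField (CoordinateRing.mk W (C X))

/-- The coordinate function `y` of a Weierstrass curve. -/
def yFun : W.FunctionField :=
  algebraMap W.CoordinateRing W.FunctionField (CoordinateRing.mk W X)

theorem xFun_eq_algebraMap : W.xFun = algebraMap K[X] W.FunctionField X := by
  rw [IsScalarTower.algebraMap_apply K[X] W.CoordinateRing W.FunctionField]
  rfl

theorem aeval_xFun (P : K[X]) : aeval W.xFun P = algebraMap K[X] W.FunctionField P := by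
  rw [xFun_eq_algebraMap, aeval_algebraMap_apply, aeval_X_left_apply]

theorem algebraMap_injective : Function.Injective (algebraMap K[X] W.FunctionField) := by
  rw [IsScalarTower.algebraMap_eq K[X] W.CoordinateRing W.FunctionField]
  refine (IsFractionRing.injective W.CoordinateRing W.FunctionField).comp ?_
  refine AdjoinRoot.of.injective_of_degree_ne_zero ?_
  rw [degree_polynomial]
  decide

theorem transcendental_xFun : Transcendental K W.xFun := by
  rw [transcendental_iff_injective]
  intro P Q h
  exact W.algebraMap_injective (by simpa only [aeval_xFun] using h)

theorem xFun_ne_zero : W.xFun ≠ 0 := by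
  intro h
  exact W.transcendental_xFun (by rw [h]; exact isAlgebraic_zero)

theorem eval₂_polynomial_eq {A : Type*} [CommRing A] (f : K[X] →+* A) (z : A) :
    W.polynomial.eval₂ f z = z ^ 2 + f (C W.a₁ * X + C W.a₃) * z -
      f (X ^ 3 + C W.a₂ * X ^ 2 + C W.a₄ * X + C W.a₆) := by
  rw [polynomial, eval₂_sub, eval₂_add, eval₂_mul, eval₂_pow, eval₂_X, eval₂_C, eval₂_C]

theorem yFun_equation :
    W.yFun ^ 2 + algebraMap K _ W.a₁ * W.xFun * W.yFun + algebraMap K _ W.a₃ * W.yFun =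
      W.xFun ^ 3 + algebraMap K _ W.a₂ * W.xFun ^ 2 + algebraMap K _ W.a₄ * W.xFun +
        algebraMap K _ W.a₆ := by
  have h := AdjoinRoot.eval₂_root W.polynomial
  rw [eval₂_polynomial_eq] at h
  have h2 := congrArg (algebraMap W.CoordinateRing W.FunctionField) h
  change algebraMap W.CoordinateRing W.FunctionField ((AdjoinRoot.root W.polynomial) ^ 2 +
    algebraMap K[X] W.CoordinateRing _ * _ - algebraMap K[X] W.CoordinateRing _) = _ at h2
  rw [map_sub, map_add, map_mul, map_pow, map_zero, ← IsScalarTower.algebraMap_apply,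
    ← IsScalarTower.algebraMap_apply, ← aeval_xFun, ← aeval_xFun] at h2
  change W.yFun ^ 2 + _ * W.yFun - _ = 0 at h2
  simp only [map_add, map_mul, map_pow, aeval_C, aeval_X] at h2
  linear_combination h2

theorem adjoin_xFun_yFun :
    IntermediateField.adjoin K (Set.range ![W.xFun, W.yFun]) = ⊤ := by
  rw [_root_.eq_top_iff]
  rintro g -
  have key : ∀ a : W.CoordinateRing, algebraMap _ W.FunctionField a ∈
      IntermediateField.adjoin K (Set.range ![W.xFun, W.yFun]) := by
    have hpol : ∀ P : K[X], algebraMap K[X] W.FunctionField P ∈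
        IntermediateField.adjoin K (Set.range ![W.xFun, W.yFun]) := fun P => by
      rw [← aeval_xFun]
      exact Algebra.adjoin_le (S := (IntermediateField.adjoin K
        (Set.range ![W.xFun, W.yFun])).toSubalgebra) (Set.singleton_subset_iff.2
        (IntermediateField.left_mem_adjoin_range (K := K) W.xFun W.yFun))
        (aeval_mem_adjoin_singleton K W.xFun)
    intro a
    obtain ⟨P, Q, rfl⟩ := CoordinateRing.exists_smul_basis_eq a
    rw [Algebra.smul_def, Algebra.smul_def, mul_one, map_add, map_mul,
      ← IsScalarTower.algebraMap_apply, ← IsScalarTower.algebraMap_apply]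
    exact add_mem (hpol P) (mul_mem (hpol Q) (IntermediateField.right_mem_adjoin_range _ _))
  obtain ⟨a, b, -, rfl⟩ := IsFractionRing.div_surjective (A := W.CoordinateRing) g
  exact div_mem (key a) (key b)

/-- The negation automorphism `(x, y) ↦ (x, -y - a₁x - a₃)` of the function field. -/
theorem exists_involution : ∃ σ : W.FunctionField →ₐ[K] W.FunctionField, σ W.xFun = W.xFun ∧
    σ W.yFun = -W.yFun - algebraMap K _ W.a₁ * W.xFun - algebraMap K _ W.a₃ := by
  let l : W.CoordinateRing := algebraMap K[X] _ (C W.a₁ * X + C W.a₃)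
  have hroot : W.polynomial.eval₂ (Algebra.ofId K[X] W.CoordinateRing).toRingHom
      (-AdjoinRoot.root W.polynomial - l) = 0 := by
    have h := AdjoinRoot.eval₂_root W.polynomial
    rw [eval₂_polynomial_eq] at h ⊢
    change (AdjoinRoot.root W.polynomial) ^ 2 + l * _ -
      algebraMap K[X] W.CoordinateRing _ = _ at h
    change (-AdjoinRoot.root W.polynomial - l) ^ 2 + l * _ -
      algebraMap K[X] W.CoordinateRing _ = _
    linear_combination h
  let τ : W.CoordinateRing →ₐ[K[X]] W.CoordinateRing :=
    AdjoinRoot.liftAlgHom W.polynomial (Algebra.ofId _ _) _ hroot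
  have hτ : τ (AdjoinRoot.root _) = -AdjoinRoot.root _ - l := AdjoinRoot.lift_root hroot
  have hl : τ l = l := τ.commutes _
  have hττ : τ.comp τ = AlgHom.id _ _ := by
    apply AdjoinRoot.algHom_ext
    rw [AlgHom.comp_apply, hτ, map_sub, map_neg, hτ, hl, AlgHom.id_apply]
    ring
  have hinj : Function.Injective τ := by
    apply Function.LeftInverse.injective (g := τ)
    intro a
    exact DFunLike.congr_fun hττ a
  let j : W.CoordinateRing →ₐ[K] W.FunctionField :=
    (IsScalarTower.toAlgHom K W.CoordinateRing W.FunctionField).comp (τ.restrictScalars K)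
  have hj : Function.Injective j :=
    (IsFractionRing.injective W.CoordinateRing W.FunctionField).comp hinj
  refine ⟨IsFractionRing.liftAlgHom hj, ?_, ?_⟩
  · rw [xFun, IsFractionRing.liftAlgHom_apply, IsFractionRing.lift_algebraMap]
    change algebraMap _ _ (τ (algebraMap K[X] _ X)) = algebraMap _ _ (algebraMap K[X] _ X)
    rw [τ.commutes]
  · rw [yFun, IsFractionRing.liftAlgHom_apply, IsFractionRing.lift_algebraMap]
    change algebraMap _ _ (τ (AdjoinRoot.root _)) = -algebraMap _ _ (AdjoinRoot.root _) - _ - _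
    have : algebraMap W.CoordinateRing W.FunctionField l =
        algebraMap K _ W.a₁ * W.xFun + algebraMap K _ W.a₃ := by
      rw [← IsScalarTower.algebraMap_apply, ← aeval_xFun]
      simp
    rw [hτ, map_sub, map_neg, this]
    ring

variable {W}

/-- The place `V` of the function field is centred at the point `P`. -/
def IsCentredAt (V : ValuationSubring W.FunctionField) : W.Point → Prop
  | .zero => V.IsResidue (W.xFun / W.yFun) (0 : K) ∧ V.IsResidue W.yFun⁻¹ (0 : K)
  | .some x y _ => V.IsResidue W.xFun x ∧ V.IsResidue W.yFun y

variable (W) in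
theorem yFun_ne_zero : W.yFun ≠ 0 := by
  intro h
  have h1 : algebraMap W.CoordinateRing W.FunctionField (CoordinateRing.mk W X) = 0 := h
  have h2 : CoordinateRing.mk W X = 0 :=
    IsFractionRing.injective W.CoordinateRing W.FunctionField (by rw [h1, map_zero])
  have := (CoordinateRing.smul_basis_eq_zero (W' := W) (p := 0) (q := 1) (by
    rw [h2]; simp)).2
  exact one_ne_zero this

variable {V : ValuationSubring W.FunctionField}

/-- `y` is integral over `K[x]`: if it had a pole, dividing the equation by `y` would express it
through finite functions. -/
theorem yFun_mem (hV : V.ContainsConstants K) (hx : W.xFun ∈ V) : W.yFun ∈ V := by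
  by_contra hy
  have h1 := mem_of_mem_nonunits (inv_mem_nonunits_of_notMem hy)
  have h0 : W.yFun ≠ 0 := by rintro h; exact hy (h ▸ V.zero_mem)
  have key : W.yFun = (W.xFun ^ 3 + algebraMap K _ W.a₂ * W.xFun ^ 2 +
      algebraMap K _ W.a₄ * W.xFun + algebraMap K _ W.a₆) * W.yFun⁻¹ -
      (algebraMap K _ W.a₁ * W.xFun + algebraMap K _ W.a₃) := by
    rw [← W.yFun_equation]
    field_simp
    ring
  apply hy
  rw [key]
  have c := hV
  exact sub_mem (mul_mem (add_mem (add_mem (add_mem (pow_mem hx 3) (mul_mem (c _) (pow_mem hx 2)))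
    (mul_mem (c _) hx)) (c _)) h1) (add_mem (mul_mem (c _) hx) (c _))

theorem isCentredAt_zero_of_notMem (hV : V.ContainsConstants K)
    (hx : W.xFun ∉ V) : IsCentredAt V .zero := by
  have hu := inv_mem_nonunits_of_notMem hx
  have hu' := mem_of_mem_nonunits hu
  have hx0 := W.xFun_ne_zero
  have hy0 := W.yFun_ne_zero
  have hz : W.yFun / W.xFun ∉ V := by
    intro hz
    apply hx
    -- The Weierstrass equation divided by `x²`: with `y / x` and `1 / x` finite, `x` would be
    -- finite.
    have key : W.xFun = (W.yFun / W.xFun) ^ 2 + algebraMap K _ W.a₁ * (W.yFun / W.xFun) +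
        algebraMap K _ W.a₃ * (W.yFun / W.xFun) * W.xFun⁻¹ -
        (algebraMap K _ W.a₂ + algebraMap K _ W.a₄ * W.xFun⁻¹ +
          algebraMap K _ W.a₆ * W.xFun⁻¹ ^ 2) := by
      have := W.yFun_equation
      field_simp
      linear_combination -this
    rw [key]
    have c := hV
    exact sub_mem (add_mem (add_mem (pow_mem hz 2) (mul_mem (c _) hz))
      (mul_mem (mul_mem (c _) hz) hu')) (add_mem (add_mem (c _) (mul_mem (c _) hu'))
      (mul_mem (c _) (pow_mem hu' 2)))
  have hs := inv_mem_nonunits_of_notMem hz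
  rw [inv_div] at hs
  refine ⟨isResidue_zero_iff.2 hs, isResidue_zero_iff.2 ?_⟩
  have := mul_mem_nonunits hs hu'
  convert this using 1
  field_simp

theorem IsCentredAt.xFun_notMem (hV : V.ContainsConstants K)
    (h : IsCentredAt V .zero) : W.xFun ∉ V := fun hx =>
  SplitQuartic.not_isResidue_inv_zero W.yFun_ne_zero (yFun_mem hV hx) h.2

theorem IsCentredAt.pointLocalRing_eq (hV : V.ContainsConstants K) {P : W.Point}
    (h : IsCentredAt V P) : W.pointLocalRing P = V := by
  cases P with
  | zero =>
    have hy := W.yFun_ne_zero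
    -- With `s = x / y` and `t = 1 / y` the curve is `t (1 + a₁s + a₃t - a₂s² - a₄st - a₆t²) = s² ·
    -- s`. The factor of `t` is `1` at the origin, so `s` is a local parameter.
    refine chartLocalRing_eq hV h.1 h.2
      (α := 1 + .C W.a₁ * .X 0 + .C W.a₃ * .X 1 - .C W.a₂ * .X 0 ^ 2 - .C W.a₄ * .X 0 * .X 1 -
        .C W.a₆ * .X 1 ^ 2) (β := .X 0 ^ 2) ?_ ?_ ?_
    · have h1 := IntermediateField.left_mem_adjoin_range (K := K) (W.xFun / W.yFun) W.yFun⁻¹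
      have h2 := IntermediateField.right_mem_adjoin_range (K := K) (W.xFun / W.yFun) W.yFun⁻¹
      have h3 := inv_mem h2
      rw [inv_inv] at h3
      refine IntermediateField.adjoin_pair_eq_top W.adjoin_xFun_yFun ?_ h3
      have := mul_mem h1 h3
      rwa [div_mul_cancel₀ _ hy] at this
    · change MvPolynomial.aeval ![W.xFun / W.yFun, W.yFun⁻¹] _ * (W.yFun⁻¹ - _) =
        MvPolynomial.aeval ![W.xFun / W.yFun, W.yFun⁻¹] _ * (W.xFun / W.yFun - _)
      simp only [map_add, map_sub, map_mul, map_pow, map_one, map_zero, MvPolynomial.aeval_X,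
        MvPolynomial.algHom_C, Matrix.cons_val_zero, Matrix.cons_val_one,
        Matrix.cons_val_fin_one, sub_zero]
      have := W.yFun_equation
      field_simp
      linear_combination this
    · left; simp
  | some x y hxy =>
    -- The difference of the equations for the coordinate functions and for the point, factored
    -- through `Y - y` and `X - x`; at the point the cofactors are the partial derivatives up to
    -- sign.
    refine chartLocalRing_eq hV h.1 h.2 W.adjoin_xFun_yFun
      (α := .X 1 + .C y + .C W.a₁ * .X 0 + .C W.a₃)
      (β := .X 0 ^ 2 + .X 0 * .C x + .C (x ^ 2) + .C W.a₂ * (.X 0 + .C x) + .C W.a₄ -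
        .C (W.a₁ * y)) ?_ ?_
    · change MvPolynomial.aeval ![W.xFun, W.yFun] _ * (W.yFun - _) =
        MvPolynomial.aeval ![W.xFun, W.yFun] _ * (W.xFun - _)
      simp only [map_add, map_sub, map_mul, map_pow, MvPolynomial.aeval_X,
        MvPolynomial.algHom_C, Matrix.cons_val_zero, Matrix.cons_val_one,
        Matrix.cons_val_fin_one]
      have h1 := W.yFun_equation
      have h2 := congrArg (algebraMap K W.FunctionField) ((equation_iff _ _).1 hxy.1)
      simp only [map_add, map_mul, map_pow] at h2
      linear_combination h1 - h2
    · have := ((nonsingular_iff' _ _).1 hxy).2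
      rcases this with h | h
      · right
        simp only [map_add, map_sub, map_mul, map_pow, MvPolynomial.eval_X, MvPolynomial.eval_C,
          Matrix.cons_val_zero]
        contrapose! h
        linear_combination -h
      · left
        simp only [map_add, map_mul, MvPolynomial.eval_X, MvPolynomial.eval_C,
          Matrix.cons_val_zero, Matrix.cons_val_one, Matrix.cons_val_fin_one]
        contrapose! h
        linear_combination h

theorem IsCentredAt.isRational (hV : V.ContainsConstants K)
    {P : W.Point} (h : IsCentredAt V P) : V.IsRational K := by
  have := h.pointLocalRing_eq hV
  cases P with
  | zero => exact isRational_of_chart hV h.1 h.2 this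
  | some x y hxy => exact isRational_of_chart hV h.1 h.2 this

theorem exists_isCentredAt (P : W.Point) :
    ∃ V : ValuationSubring W.FunctionField, V.ContainsConstants K ∧ IsCentredAt V P := by
  cases P with
  | zero =>
    obtain ⟨V, hV, h⟩ := exists_place_of_transcendental (K := K) (w := W.xFun⁻¹)
      (fun h => W.transcendental_xFun (by simpa using h.inv))
    refine ⟨V, hV, isCentredAt_zero_of_notMem hV ?_⟩
    have := (inv_mem_nonunits_iff _).1 h
    exact this.resolve_left W.xFun_ne_zero
  | some x y hxy =>
    -- The quotient by this ideal is `K`, which is not the zero ring.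
    have hI : CoordinateRing.XYIdeal W x (C y) ≠ ⊤ := by
      intro h
      have e := CoordinateRing.quotientXYIdealEquiv (W' := W) (x := x) (y := C y) hxy.1
      have := Ideal.Quotient.subsingleton_iff.2 h
      exact not_subsingleton K e.symm.toEquiv.subsingleton
    obtain ⟨V, hV, -, h⟩ := exists_place_of_ideal
      (IsScalarTower.toAlgHom K W.CoordinateRing W.FunctionField)
      (IsFractionRing.injective W.CoordinateRing W.FunctionField) hI
    refine ⟨V, hV, ?_, ?_⟩
    · have := h (CoordinateRing.XClass W x) (Ideal.subset_span (by simp))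
      rw [CoordinateRing.XClass, map_sub, map_sub, map_sub] at this
      exact this
    · have := h (CoordinateRing.YClass W (C y)) (Ideal.subset_span (by simp))
      rw [CoordinateRing.YClass, map_sub, map_sub] at this
      exact this

theorem exists_point_of_isRational [W.IsElliptic] (hV : V.IsRational K) :
    ∃ P : W.Point, IsCentredAt V P := by
  have hK := hV.constants
  by_cases hx : W.xFun ∈ V
  · obtain ⟨p, hp⟩ := hV.exists_residue _ hx
    obtain ⟨q, hq⟩ := hV.exists_residue _ (yFun_mem hK hx)
    have hc := fun c : K => isResidue_algebraMap (V := V) c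
    have h1 := (((hq.pow hK 2).add (((hc W.a₁).mul hK hp).mul hK hq)).add ((hc W.a₃).mul hK hq))
    rw [W.yFun_equation] at h1
    have h2 := h1.eq hK ((((hp.pow hK 3).add ((hc W.a₂).mul hK (hp.pow hK 2))).add
      ((hc W.a₄).mul hK hp)).add (hc W.a₆))
    exact ⟨.some p q (equation_iff_nonsingular.1 ((equation_iff _ _).2 h2)), hp, hq⟩
  · exact ⟨.zero, isCentredAt_zero_of_notMem hK hx⟩

theorem IsCentredAt.unique (hV : V.ContainsConstants K) {P P' : W.Point}
    (h : IsCentredAt V P) (h' : IsCentredAt V P') : P = P' := by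
  cases P with
  | some x y hxy =>
    cases P' with
    | some x' y' hxy' =>
      obtain rfl := h.1.eq hV h'.1
      obtain rfl := h.2.eq hV h'.2
      rfl
    | zero => exact absurd (h.1.mem hV) (h'.xFun_notMem hV)
  | zero =>
    cases P' with
    | some x' y' hxy' => exact absurd (h'.1.mem hV) (h.xFun_notMem hV)
    | zero => rfl

end WeierstrassCurve.Affine

theorem two_ne_zero_of_algebra {K F : Type*} [Field K] [Field F] [Algebra K F]
    (h2 : (2 : K) ≠ 0) : (2 : F) ≠ 0 := by
  rw [← map_ofNat (algebraMap K F) 2]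
  exact (_root_.map_ne_zero _).2 h2

/-! ### Functions regular on the affine part of an elliptic curve. -/

namespace WeierstrassCurve.Affine

variable {K : Type*} [Field K] (W : WeierstrassCurve.Affine K)

/-- The `2`-division polynomial `4x³ + b₂x² + 2b₄x + b₆`. -/
def twoDivision : K[X] := C 4 * X ^ 3 + C W.b₂ * X ^ 2 + C (2 * W.b₄) * X + C W.b₆

/-- The function `2y + a₁x + a₃`, a square root of the `2`-division polynomial. -/
def etaFun : W.FunctionField :=
  2 * W.yFun + algebraMap K _ W.a₁ * W.xFun + algebraMap K _ W.a₃

theorem etaFun_sq : W.etaFun ^ 2 = aeval W.xFun W.twoDivision := by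
  have h := W.yFun_equation
  simp only [etaFun, twoDivision, WeierstrassCurve.b₂, WeierstrassCurve.b₄, WeierstrassCurve.b₆,
    map_add, map_mul, map_pow, aeval_C, aeval_X, map_ofNat]
  linear_combination 4 * h

theorem eval_twoDivision (x y : K) (h : W.Equation x y) :
    W.twoDivision.eval x = (2 * y + W.a₁ * x + W.a₃) ^ 2 := by
  rw [equation_iff] at h
  simp [twoDivision, WeierstrassCurve.b₂, WeierstrassCurve.b₄, WeierstrassCurve.b₆]
  linear_combination -4 * h

variable {W}

/-- A square factor of a cubic is at most linear, so a nontrivial one yields a rational double root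
`r`. Then the point above `r` with `2y + a₁x + a₃ = 0` would be singular. -/
theorem squarefree_twoDivision [W.IsElliptic] (h2 : (2 : K) ≠ 0) : Squarefree W.twoDivision := by
  have h4 : (4 : K) ≠ 0 := by
    rw [show (4 : K) = 2 * 2 by norm_num]; exact mul_ne_zero h2 h2
  have hdeg : W.twoDivision.natDegree = 3 := natDegree_cubic h4
  have hne : W.twoDivision ≠ 0 := by rintro h; simp [h] at hdeg
  rintro h ⟨k, hk⟩
  have hh : h ≠ 0 := by rintro rfl; simp at hk; exact hne hk
  have hk0 : k ≠ 0 := by rintro rfl; simp at hk; exact hne hk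
  have hd : 2 * h.natDegree + k.natDegree = 3 := by
    rw [← hdeg, hk, natDegree_mul (mul_ne_zero hh hh) hk0, natDegree_mul hh hh]
    ring
  rcases Nat.lt_or_ge h.natDegree 1 with h0 | h1
  · rw [isUnit_iff_degree_eq_zero, degree_eq_natDegree hh]
    have : h.natDegree = 0 := by omega
    simp [this]
  · exfalso
    have h1 : h.degree = 1 := by rw [degree_eq_natDegree hh]; norm_cast; omega
    obtain ⟨r, hr : h.eval r = 0⟩ := exists_root_of_degree_eq_one h1
    have e1 : W.twoDivision.eval r = 0 := by rw [hk]; simp [hr]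
    have e2 : W.twoDivision.derivative.eval r = 0 := by rw [hk]; simp [hr]
    simp only [twoDivision, WeierstrassCurve.b₂, WeierstrassCurve.b₄, WeierstrassCurve.b₆,
      derivative_add, derivative_mul, derivative_C, derivative_X_pow, derivative_X,
      eval_add, eval_mul, eval_pow, eval_C, eval_X, eval_zero, eval_one] at e1 e2
    norm_num at e1 e2
    set z : K := -(W.a₁ * r + W.a₃) / 2 with hz
    have hz2 : 2 * z = -(W.a₁ * r + W.a₃) := by rw [hz]; field_simp
    have heq : W.Equation r z := by
      rw [equation_iff]
      apply mul_left_cancel₀ h4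
      linear_combination (2 * z + W.a₁ * r + W.a₃) * hz2 - e1
    have hns := ((nonsingular_iff' _ _).1 (equation_iff_nonsingular.1 heq)).2
    rcases hns with h | h
    · apply h
      apply mul_left_cancel₀ h4
      linear_combination 2 * W.a₁ * hz2 - e2
    · apply h
      linear_combination hz2

variable (W) in
/-- A function without poles on the affine part of the curve. -/
def IsRegular (g : W.FunctionField) : Prop :=
  ∀ V : ValuationSubring W.FunctionField, V.ContainsConstants K → W.xFun ∈ V → g ∈ V

/-- In lowest terms, a nonconstant denominator vanishes at some place where `x` is finite.
Regularity makes the numerator vanish there too, against Bézout. -/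
theorem exists_polynomial_of_isRegular {P R : K[X]} (hR : R ≠ 0)
    (h : W.IsRegular (aeval W.xFun P / aeval W.xFun R)) :
    ∃ T : K[X], aeval W.xFun P / aeval W.xFun R = aeval W.xFun T := by
  have hinj := transcendental_iff_injective.1 W.transcendental_xFun
  obtain ⟨d, P', R', hP, hR', hcop⟩ : ∃ d P' R', P = d * P' ∧ R = d * R' ∧ IsCoprime P' R' := by
    classical
    obtain ⟨P', hP'⟩ := EuclideanDomain.gcd_dvd_left P R
    obtain ⟨R', hR'⟩ := EuclideanDomain.gcd_dvd_right P R
    refine ⟨_, P', R', hP', hR', ?_⟩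
    have h0 : EuclideanDomain.gcd P R ≠ 0 := by
      intro h0; rw [h0, zero_mul] at hR'; exact hR hR'
    refine ⟨EuclideanDomain.gcdA P R, EuclideanDomain.gcdB P R, mul_left_cancel₀ h0 ?_⟩
    have := EuclideanDomain.gcd_eq_gcd_ab P R
    linear_combination -this - EuclideanDomain.gcdA P R * hP' - EuclideanDomain.gcdB P R * hR'
  have hd : aeval W.xFun d ≠ 0 := by
    rw [Ne, ← map_zero (aeval (R := K) W.xFun), hinj.eq_iff]
    rintro rfl
    exact hR (by rw [hR', zero_mul])
  have hR'0 : aeval W.xFun R' ≠ 0 := by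
    rw [Ne, ← map_zero (aeval (R := K) W.xFun), hinj.eq_iff]
    rintro rfl
    exact hR (by rw [hR', mul_zero])
  rw [hP, hR', map_mul, map_mul, mul_div_mul_left _ _ hd] at h ⊢
  by_cases hu : IsUnit R'
  · obtain ⟨S, hS⟩ := hu.exists_right_inv
    refine ⟨P' * S, ?_⟩
    rw [div_eq_iff hR'0, ← map_mul, mul_assoc, mul_comm S, hS, mul_one]
  · exfalso
    obtain ⟨V, hV, hmem, hI⟩ := exists_place_of_ideal (aeval (R := K) W.xFun) hinj
      (I := Ideal.span {R'}) (by rwa [Ne, Ideal.span_singleton_eq_top])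
    have h1 := h V hV (by simpa using hmem X)
    have hR'm := hI R' (Ideal.mem_span_singleton_self R')
    have h2 := mul_mem_nonunits hR'm h1
    rw [mul_div_cancel₀ _ hR'0] at h2
    obtain ⟨A, B, hAB⟩ := hcop
    have h3 := V.nonunits.add_mem (mul_mem_nonunits h2 (hmem A)) (mul_mem_nonunits hR'm (hmem B))
    rw [← map_mul, ← map_mul, ← map_add, mul_comm, mul_comm R', hAB, map_one] at h3
    exact one_notMem_nonunits h3

theorem isRegular_etaFun : W.IsRegular W.etaFun := by
  intro V hV hx
  apply mem_of_sq_mem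
  have key : ∀ P : K[X], aeval W.xFun P ∈ V := fun P => by
    induction P using Polynomial.induction_on' with
    | add P Q hP hQ => rw [map_add]; exact add_mem hP hQ
    | monomial n a => rw [aeval_monomial]; exact mul_mem (hV a) (pow_mem hx n)
  rw [etaFun_sq]
  exact key _

/-- Rationalise the denominator: multiply by its conjugate under the negation automorphism, so that
it becomes its norm, a polynomial in `x`. -/
theorem exists_eq_div (h2 : (2 : K) ≠ 0) (g : W.FunctionField) : ∃ P Q R : K[X], R ≠ 0 ∧
    g = (aeval W.xFun P + aeval W.xFun Q * W.etaFun) / aeval W.xFun R := by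
  have hinj := transcendental_iff_injective.1 W.transcendental_xFun
  obtain ⟨σ, hσx, hσy⟩ := W.exists_involution
  have h2' : (2 : W.FunctionField) ≠ 0 := two_ne_zero_of_algebra h2
  have hση : σ W.etaFun = -W.etaFun := by
    simp only [etaFun, map_add, map_mul, map_ofNat, hσx, hσy, AlgHom.commutes]
    ring
  have hσP : ∀ P : K[X], σ (aeval W.xFun P) = aeval W.xFun P := fun P => by
    rw [← aeval_algHom_apply, hσx]
  have key : ∀ a : W.CoordinateRing, ∃ P Q : K[X],
      algebraMap _ W.FunctionField a = aeval W.xFun P + aeval W.xFun Q * W.etaFun := by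
    intro a
    obtain ⟨P, Q, rfl⟩ := CoordinateRing.exists_smul_basis_eq a
    refine ⟨P - C 2⁻¹ * Q * (C W.a₁ * X + C W.a₃), C 2⁻¹ * Q, ?_⟩
    rw [Algebra.smul_def, Algebra.smul_def, mul_one, map_add, map_mul,
      ← IsScalarTower.algebraMap_apply, ← IsScalarTower.algebraMap_apply, ← aeval_xFun,
      ← aeval_xFun]
    change aeval W.xFun P + aeval W.xFun Q * W.yFun = _
    simp only [map_sub, map_mul, map_add, aeval_C, aeval_X, map_inv₀, map_ofNat, etaFun]
    field_simp
    ring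
  obtain ⟨a, b, hb, rfl⟩ := IsFractionRing.div_surjective (A := W.CoordinateRing) g
  obtain ⟨P, Q, hPQ⟩ := key a
  obtain ⟨P', Q', hPQ'⟩ := key b
  have hb0 : algebraMap W.CoordinateRing W.FunctionField b ≠ 0 := by
    simpa using nonZeroDivisors.ne_zero hb
  have hσb : σ (algebraMap W.CoordinateRing W.FunctionField b) ≠ 0 := by simpa using hb0
  have hσb' : σ (algebraMap W.CoordinateRing W.FunctionField b) =
      aeval W.xFun P' - aeval W.xFun Q' * W.etaFun := by
    rw [hPQ', map_add, map_mul, hσP, hσP, hση]; ring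
  have hnorm : algebraMap W.CoordinateRing W.FunctionField b *
      σ (algebraMap W.CoordinateRing W.FunctionField b) =
      aeval W.xFun (P' ^ 2 - Q' ^ 2 * W.twoDivision) := by
    rw [hσb', hPQ', map_sub, map_mul, map_pow, map_pow, ← etaFun_sq]
    ring
  refine ⟨P * P' - Q * Q' * W.twoDivision, Q * P' - P * Q', P' ^ 2 - Q' ^ 2 * W.twoDivision,
    ?_, ?_⟩
  · intro h
    rw [h, map_zero] at hnorm
    exact mul_ne_zero hb0 hσb hnorm
  · rw [← hnorm, ← mul_div_mul_right _ _ hσb, hPQ, hσb']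
    simp only [map_sub, map_mul, ← etaFun_sq]
    congr 1
    ring

/-- The affine coordinate ring of an elliptic curve is integrally closed: a function without
poles on the affine part is of the form `P(x) + Q(x) (2y + a₁x + a₃)`. -/
theorem IsRegular.exists_eq [W.IsElliptic] (h2 : (2 : K) ≠ 0) {g : W.FunctionField}
    (hg : W.IsRegular g) :
    ∃ P Q : K[X], g = aeval W.xFun P + aeval W.xFun Q * W.etaFun := by
  have hinj := transcendental_iff_injective.1 W.transcendental_xFun
  have hne : ∀ {P : K[X]}, P ≠ 0 → aeval W.xFun P ≠ 0 := fun {P} hP h =>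
    hP (hinj (by rw [h, map_zero]))
  obtain ⟨σ, hσx, hσy⟩ := W.exists_involution
  have h2' : (2 : W.FunctionField) ≠ 0 := two_ne_zero_of_algebra h2
  have hση : σ W.etaFun = -W.etaFun := by
    simp only [etaFun, map_add, map_mul, map_ofNat, hσx, hσy, AlgHom.commutes]
    ring
  have hσP : ∀ P : K[X], σ (aeval W.xFun P) = aeval W.xFun P := fun P => by
    rw [← aeval_algHom_apply, hσx]
  obtain ⟨P, Q, R, hR, hgPQ⟩ := exists_eq_div h2 g
  have hR' := hne hR
  have hσg : σ g = (aeval W.xFun P - aeval W.xFun Q * W.etaFun) / aeval W.xFun R := by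
    rw [hgPQ, map_div₀, map_add, map_mul, hσP, hσP, hσP, hση]
    ring
  have hσreg : W.IsRegular (σ g) := fun V hV hx => by
    have := hg (V.comap (σ : W.FunctionField →+* W.FunctionField)) (hV.comap σ)
      (by rw [mem_comap]; simpa [hσx] using hx)
    exact mem_comap.1 this
  -- The trace `g + σ g = 2P / R` is regular and lies in `K(x)`, hence is a polynomial.
  obtain ⟨T₁, hT₁⟩ := exists_polynomial_of_isRegular (W := W) (P := 2 * P) hR (by
    intro V hV hx
    have := add_mem (hg V hV hx) (hσreg V hV hx)
    convert this using 1
    rw [hσg, hgPQ, map_mul, map_ofNat]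
    ring)
  -- `g - σ g` is not itself in `K(x)`, but its product with `etaFun` and its square are; these
  -- become the polynomials `T` and `M`, with `T² = M · twoDivision`.
  have hregsq : ∀ V : ValuationSubring W.FunctionField, V.ContainsConstants K → W.xFun ∈ V →
      aeval W.xFun (2 * Q * W.twoDivision) / aeval W.xFun R ∈ V := by
    intro V hV hx
    have h1 := sub_mem (hg V hV hx) (hσreg V hV hx)
    have h3 := mul_mem h1 (isRegular_etaFun V hV hx)
    convert h3 using 1
    rw [hσg, hgPQ, map_mul, map_mul, map_ofNat, ← etaFun_sq]
    ring
  obtain ⟨T, hT⟩ := exists_polynomial_of_isRegular hR hregsq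
  obtain ⟨M, hM⟩ := exists_polynomial_of_isRegular (W := W) (P := 4 * Q ^ 2 * W.twoDivision)
    (R := R ^ 2) (pow_ne_zero 2 hR) (by
      intro V hV hx
      have h1 := pow_mem (sub_mem (hg V hV hx) (hσreg V hV hx)) 2
      convert h1 using 1
      rw [hσg, hgPQ, map_mul, map_mul, map_ofNat, ← etaFun_sq, map_pow, map_pow]
      field_simp
      ring)
  have hTM : T ^ 2 = M * W.twoDivision := by
    apply hinj
    rw [map_mul, map_pow, ← hT, ← hM]
    simp only [map_mul, map_pow, map_ofNat]
    field_simp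
    ring
  have hD0 : W.twoDivision ≠ 0 := (squarefree_twoDivision h2).ne_zero
  -- Squarefreeness lets `twoDivision ∣ T²` descend to `T`; cancelling it shows that `2Q / R` is a
  -- polynomial.
  obtain ⟨T', rfl⟩ : W.twoDivision ∣ T :=
    (squarefree_twoDivision h2).isRadical 2 T ⟨M, by rw [hTM, mul_comm]⟩
  have hQ : 2 * aeval W.xFun Q / aeval W.xFun R = aeval W.xFun T' := by
    apply mul_left_cancel₀ (hne hD0)
    rw [← map_mul, ← hT]
    simp only [map_mul, map_ofNat]
    ring
  refine ⟨C 2⁻¹ * T₁, C 2⁻¹ * T', ?_⟩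
  rw [map_mul, map_mul, ← hT₁, ← hQ, hgPQ]
  simp only [map_mul, map_ofNat, aeval_C, map_inv₀]
  field_simp

end WeierstrassCurve.Affine

theorem ValuationSubring.IsResidue.sum {K F ι : Type*} [Field K] [Field F] [Algebra K F]
    {V : ValuationSubring F} {s : Finset ι} {g : ι → F} {c : ι → K}
    (h : ∀ i ∈ s, V.IsResidue (g i) (c i)) : V.IsResidue (∑ i ∈ s, g i) (∑ i ∈ s, c i) := by
  classical
  induction s using Finset.induction_on with
  | empty => simpa using isResidue_algebraMap (V := V) (0 : K)
  | insert a s ha ih =>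
    rw [Finset.sum_insert ha, Finset.sum_insert ha]
    exact (h a (Finset.mem_insert_self _ _)).add
      (ih fun i hi => h i (Finset.mem_insert_of_mem hi))

theorem ValuationSubring.IsResidue.ne_zero {K F : Type*} [Field K] [Field F] [Algebra K F]
    {V : ValuationSubring F} {g : F} {c : K} (hV : V.ContainsConstants K) (hg : V.IsResidue g c)
    (hc : c ≠ 0) : g ≠ 0 := by
  rintro rfl
  exact hc ((hg.mem_nonunits_iff hV).1 V.nonunits.zero_mem)

/-! ### Pole orders at the origin; squares in the function field. -/

namespace WeierstrassCurve.Affine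

variable {K : Type*} [Field K] {W : WeierstrassCurve.Affine K}

section Infinity

variable {V : ValuationSubring W.FunctionField}

/-- With `s = x / y`, the equation gives `x s² = x³ / y² = (1 + a₁s + a₃/y) / (1 + a₂/x + a₄/x² +
a₆/x³)`, and every nonconstant term vanishes at the origin. -/
theorem isResidue_xFun_mul_sq (hV : V.ContainsConstants K) (h : IsCentredAt V .zero) :
    V.IsResidue (W.xFun * (W.xFun / W.yFun) ^ 2) (1 : K) := by
  have hu : V.IsResidue W.xFun⁻¹ (0 : K) :=
    isResidue_zero_iff.2 (inv_mem_nonunits_of_notMem (h.xFun_notMem hV))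
  have hc := fun c : K => isResidue_algebraMap (V := V) c
  have hn := ((hc 1).add ((hc W.a₁).mul hV h.1)).add ((hc W.a₃).mul hV h.2)
  have hd := (((hc 1).add ((hc W.a₂).mul hV hu)).add ((hc W.a₄).mul hV (hu.pow hV 2))).add
    ((hc W.a₆).mul hV (hu.pow hV 3))
  have hd1 : (1 + W.a₂ * 0 + W.a₄ * 0 ^ 2 + W.a₆ * 0 ^ 3 : K) ≠ 0 := by simp
  have hd0 := hd.ne_zero hV hd1
  have key := hn.div hV hd hd1
  have hx := W.xFun_ne_zero
  have hy := W.yFun_ne_zero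
  have e : W.xFun * (W.xFun / W.yFun) ^ 2 =
      (algebraMap K W.FunctionField 1 + algebraMap K _ W.a₁ * (W.xFun / W.yFun) +
        algebraMap K _ W.a₃ * W.yFun⁻¹) / (algebraMap K _ 1 + algebraMap K _ W.a₂ * W.xFun⁻¹ +
        algebraMap K _ W.a₄ * W.xFun⁻¹ ^ 2 + algebraMap K _ W.a₆ * W.xFun⁻¹ ^ 3) := by
    rw [eq_div_iff hd0]
    have := W.yFun_equation
    rw [map_one]
    field_simp
    linear_combination -this
  rw [e]
  simpa using key

theorem isResidue_etaFun_mul_cube (hV : V.ContainsConstants K) (h : IsCentredAt V .zero) :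
    V.IsResidue (W.etaFun * (W.xFun / W.yFun) ^ 3) (2 : K) := by
  have hc := fun c : K => isResidue_algebraMap (V := V) c
  have hn := (((hc 2).add ((hc W.a₁).mul hV h.1)).add ((hc W.a₃).mul hV h.2)).mul hV
    (isResidue_xFun_mul_sq hV h)
  have hy := W.yFun_ne_zero
  convert hn using 1
  · rw [etaFun, map_ofNat]
    field_simp
  · simp

theorem isResidue_aeval_xFun (hV : V.ContainsConstants K) (h : IsCentredAt V .zero) {P : K[X]}
    {n : ℕ} (hn : P.natDegree ≤ n) :
    V.IsResidue (aeval W.xFun P * (W.xFun / W.yFun) ^ (2 * n)) (P.coeff n) := by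
  rw [aeval_eq_sum_range' (Nat.lt_succ_of_le hn), Finset.sum_mul]
  -- The term of degree `i` times `s ^ (2 * n)` is its coefficient times `(x s²)^i s^(2 (n - i))`;
  -- only `i = n` survives.
  have h1 : P.coeff n = ∑ i ∈ Finset.range (n + 1), P.coeff i * (1 ^ i * 0 ^ (2 * (n - i))) := by
    rw [Finset.sum_range_succ, Finset.sum_eq_zero]
    · simp
    · intro i hi
      have : 2 * (n - i) ≠ 0 := by have := Finset.mem_range.1 hi; omega
      rw [zero_pow this]; simp
  rw [h1]
  refine IsResidue.sum fun i hi => ?_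
  have h2 := (isResidue_algebraMap (V := V) (P.coeff i)).mul hV
    (((isResidue_xFun_mul_sq hV h).pow hV i).mul hV (h.1.pow hV (2 * (n - i))))
  convert h2 using 1
  have h3 : 2 * n = 2 * i + 2 * (n - i) := by have := Finset.mem_range.1 hi; omega
  rw [h3, pow_add, pow_mul, Algebra.smul_def, mul_pow]
  ring

/-- A function whose only pole is a pole of order at most two at the origin is an affine linear
function of `x`. -/
theorem IsRegular.exists_eq_linear [W.IsElliptic] (h2 : (2 : K) ≠ 0) (hV : V.ContainsConstants K)
    (h : IsCentredAt V .zero) {g : W.FunctionField} (hg : W.IsRegular g)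
    (hgV : g * (W.xFun / W.yFun) ^ 2 ∈ V) :
    ∃ c d : K, g = algebraMap K _ c * W.xFun + algebraMap K _ d := by
  obtain ⟨P, Q, rfl⟩ := hg.exists_eq h2
  set s := W.xFun / W.yFun with hs
  have hs0 : s ∈ V.nonunits := isResidue_zero_iff.1 h.1
  have hzero : ∀ k, V.IsResidue (s ^ (k + 1)) (0 : K) := fun k => by
    simpa using h.1.pow hV (k + 1)
  have hpole : ∀ k, 3 ≤ k → V.IsResidue
      ((aeval W.xFun P + aeval W.xFun Q * W.etaFun) * s ^ k) (0 : K) := by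
    intro k hk
    obtain ⟨j, rfl⟩ := Nat.exists_eq_add_of_le' hk
    have := mul_mem_nonunits (isResidue_zero_iff.1 (hzero j)) hgV
    rw [isResidue_zero_iff]
    convert this using 1
    ring
  -- The summands have pole orders `2 deg P` and `2 deg Q + 3`. Their parities differ, so the
  -- leading terms cannot cancel, and `Q ≠ 0` would force a pole of order at least three.
  have hQ : Q = 0 := by
    by_contra hQ
    have h1 := (isResidue_aeval_xFun hV h (le_refl Q.natDegree)).mul hV
      (isResidue_etaFun_mul_cube hV h)
    have h0 := isResidue_aeval_xFun hV h (le_refl P.natDegree)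
    rw [← hs] at h0 h1
    rcases Nat.lt_or_ge (2 * P.natDegree) (2 * Q.natDegree + 3) with hlt | hge
    · obtain ⟨j, hj⟩ := Nat.exists_eq_add_of_lt hlt
      have h3 := (h0.mul hV (hzero j)).add h1
      have h4 := (hpole (2 * Q.natDegree + 3) (by omega)).eq hV (by
        convert h3 using 1
        rw [add_mul, mul_assoc (aeval W.xFun P), ← pow_add, ← add_assoc, ← hj, pow_add]
        ring)
      rw [mul_zero, zero_add] at h4
      exact mul_ne_zero (leadingCoeff_ne_zero.2 hQ) h2 h4.symm
    · obtain ⟨j, hj⟩ := Nat.exists_eq_add_of_lt (show 2 * Q.natDegree + 3 < 2 * P.natDegree by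
        omega)
      have h3 := h0.add (h1.mul hV (hzero j))
      have h4 := (hpole (2 * P.natDegree) (by omega)).eq hV (by
        convert h3 using 1
        have : s ^ (2 * P.natDegree) = s ^ (2 * Q.natDegree) * s ^ 3 * s ^ (j + 1) := by
          rw [hj, ← pow_add, ← pow_add]; rfl
        rw [add_mul]
        congr 1
        rw [this]
        ring)
      rw [mul_zero, add_zero] at h4
      refine leadingCoeff_ne_zero.2 (fun hP => ?_) h4.symm
      rw [hP, natDegree_zero] at hge
      omega
  subst hQ
  have hP : P.natDegree ≤ 1 := by
    by_contra! hP
    have h0 := isResidue_aeval_xFun hV h (le_refl P.natDegree)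
    have h4 := (hpole (2 * P.natDegree) (by omega)).eq hV (by simpa using h0)
    refine leadingCoeff_ne_zero.2 (fun hP' => ?_) h4.symm
    rw [hP', natDegree_zero] at hP
    omega
  obtain ⟨c, d, rfl⟩ := exists_eq_X_add_C_of_natDegree_le_one hP
  exact ⟨c, d, by simp⟩

end Infinity

theorem eq_zero_of_add_mul_etaFun_eq_zero (h2 : (2 : K) ≠ 0) {P Q : K[X]}
    (h : aeval W.xFun P + aeval W.xFun Q * W.etaFun = 0) : P = 0 ∧ Q = 0 := by
  have h1 : (P + Q * (C W.a₁ * X + C W.a₃)) • (1 : W.CoordinateRing) +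
      (2 * Q) • CoordinateRing.mk W X = 0 := by
    apply IsFractionRing.injective W.CoordinateRing W.FunctionField
    rw [Algebra.smul_def, Algebra.smul_def, mul_one, map_add, map_mul,
      ← IsScalarTower.algebraMap_apply, ← IsScalarTower.algebraMap_apply, ← aeval_xFun,
      ← aeval_xFun]
    change _ + aeval W.xFun (2 * Q) * W.yFun = _
    rw [map_zero, ← h]
    simp only [map_mul, map_add, aeval_C, aeval_X, map_ofNat, etaFun]
    ring
  obtain ⟨h3, h4⟩ := CoordinateRing.smul_basis_eq_zero h1
  have h20 : (2 : K[X]) ≠ 0 := by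
    rw [← map_ofNat C 2]; exact C_ne_zero.2 h2
  obtain rfl := (mul_eq_zero.1 h4).resolve_left h20
  simpa using h3

/-- If `c³ (x - e₁) (x - e₂) (x - e₃)` is a square in the function field of an elliptic curve, then
`c` is a square and `e₁, e₂, e₃` are the abscissae of the points of order two. -/
theorem twoDivision_eq_of_sq [W.IsElliptic] (h2 : (2 : K) ≠ 0) {g : W.FunctionField} {c : K}
    (hc : c ≠ 0) {e₁ e₂ e₃ : K} (hg : g ^ 2 = aeval W.xFun
      (C (c ^ 3) * ((X - C e₁) * (X - C e₂) * (X - C e₃)))) :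
    IsSquare c ∧ W.twoDivision = C 4 * ((X - C e₁) * (X - C e₂) * (X - C e₃)) := by
  have h4 : (4 : K) ≠ 0 := by
    rw [show (4 : K) = 2 * 2 by norm_num]; exact mul_ne_zero h2 h2
  set f : K[X] := (X - C e₁) * (X - C e₂) * (X - C e₃) with hf
  have hfm : f.Monic := ((monic_X_sub_C _).mul (monic_X_sub_C _)).mul (monic_X_sub_C _)
  have hfd : f.natDegree = 3 := by
    rw [hf, ((monic_X_sub_C _).mul (monic_X_sub_C _)).natDegree_mul (monic_X_sub_C _),
      (monic_X_sub_C _).natDegree_mul (monic_X_sub_C _)]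
    simp
  have hDd : W.twoDivision.natDegree = 3 := natDegree_cubic h4
  have hDl : W.twoDivision.leadingCoeff = 4 := leadingCoeff_cubic h4
  have hD0 : W.twoDivision ≠ 0 := by rintro h; simp [h] at hDd
  have hc3 : c ^ 3 ≠ 0 := pow_ne_zero 3 hc
  have hreg : W.IsRegular g := by
    intro V hV hx
    apply mem_of_sq_mem
    rw [hg]
    have key : ∀ P : K[X], aeval W.xFun P ∈ V := fun P => by
      induction P using Polynomial.induction_on' with
      | add P Q hP hQ => rw [map_add]; exact add_mem hP hQ
      | monomial n a => rw [aeval_monomial]; exact mul_mem (hV a) (pow_mem hx n)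
    exact key _
  obtain ⟨P, Q, rfl⟩ := hreg.exists_eq h2
  -- Squaring `P + Q η` and comparing coefficients over `K[x]` gives `P² + Q² · twoDivision = c³ f`
  -- and `2PQ = 0`. The case `Q = 0` is excluded because `f` has odd degree.
  have h1 : aeval W.xFun (P ^ 2 + Q ^ 2 * W.twoDivision - C (c ^ 3) * f) +
      aeval W.xFun (2 * P * Q) * W.etaFun = 0 := by
    rw [map_sub, ← hg]
    simp only [map_add, map_mul, map_pow, map_ofNat, ← etaFun_sq]
    ring
  obtain ⟨h3, h5⟩ := eq_zero_of_add_mul_etaFun_eq_zero h2 h1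
  have h20 : (2 : K[X]) ≠ 0 := by
    rw [← map_ofNat C 2]; exact C_ne_zero.2 h2
  have hPQ : P = 0 ∨ Q = 0 := by
    rcases mul_eq_zero.1 h5 with h | h
    · exact Or.inl ((mul_eq_zero.1 h).resolve_left h20)
    · exact Or.inr h
  have hdeg : (C (c ^ 3) * f).natDegree = 3 := by rw [natDegree_C_mul hc3, hfd]
  rcases hPQ with rfl | rfl
  · have h6 : Q ^ 2 * W.twoDivision = C (c ^ 3) * f := by linear_combination h3
    have hQ0 : Q ≠ 0 := by
      rintro rfl
      rw [zero_pow two_ne_zero, zero_mul] at h6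
      rw [← h6, natDegree_zero] at hdeg
      omega
    have hQd : Q.natDegree = 0 := by
      have := congrArg natDegree h6
      rw [natDegree_mul (pow_ne_zero 2 hQ0) hD0, natDegree_pow, hDd, hdeg] at this
      omega
    obtain ⟨q, rfl⟩ := natDegree_eq_zero.1 hQd
    have hq : q ≠ 0 := fun h => hQ0 (by rw [h, map_zero])
    have h7 : q ^ 2 * 4 = c ^ 3 := by
      have := congrArg leadingCoeff h6
      rwa [leadingCoeff_mul, leadingCoeff_pow, leadingCoeff_C, hDl, leadingCoeff_mul,
        leadingCoeff_C, hfm.leadingCoeff, mul_one] at this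
    -- `Q` is a constant `q` with `4q² = c³`, so `c = (2q / c)²`.
    refine ⟨⟨2 * q / c, ?_⟩, ?_⟩
    · field_simp
      linear_combination -h7
    · apply mul_left_cancel₀ (pow_ne_zero 2 hQ0)
      rw [h6, ← h7, map_mul, map_pow]
      ring
  · exfalso
    have h6 : P ^ 2 = C (c ^ 3) * f := by linear_combination h3
    have := congrArg natDegree h6
    rw [natDegree_pow, hdeg] at this
    omega

end WeierstrassCurve.Affine

/-! ### Division by two with full rational 2-torsion. -/

namespace WeierstrassCurve.Affine

variable {K : Type*} [Field K] [DecidableEq K] {W : WeierstrassCurve.Affine K} {e₁ e₂ e₃ : K}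

/-- The duplication formula relative to a point `(e₁, _)` of order two. -/
theorem addX_self_sub_mul_sq (h2 : (2 : K) ≠ 0)
    (hD : W.twoDivision = C 4 * ((X - C e₁) * (X - C e₂) * (X - C e₃))) {u v : K}
    (heq : W.Equation u v) (hv : v ≠ W.negY u v) :
    (W.addX u u (W.slope u u v v) - e₁) * (2 * v + W.a₁ * u + W.a₃) ^ 2 =
      ((u - e₁) ^ 2 - (e₁ - e₂) * (e₁ - e₃)) ^ 2 := by
  have h4 : (4 : K) ≠ 0 := by
    rw [show (4 : K) = 2 * 2 by norm_num]; exact mul_ne_zero h2 h2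
  have hη : 2 * v + W.a₁ * u + W.a₃ ≠ 0 := by
    intro h
    apply hv
    rw [negY]
    linear_combination h
  have hD1 := W.eval_twoDivision u v heq
  have hD2 := congrArg (fun p => p.derivative.eval u) hD
  have hc2 := congrArg (fun p => p.coeff 2) hD
  simp only [hD] at hD1
  simp only [twoDivision, WeierstrassCurve.b₂, WeierstrassCurve.b₄, derivative_add,
    derivative_sub, derivative_mul, derivative_C, derivative_X_pow, derivative_X, eval_add,
    eval_sub, eval_mul, eval_pow, eval_C, eval_X, eval_zero, eval_one, map_natCast] at hD1 hD2
  have hc2 : W.a₁ ^ 2 + 4 * W.a₂ = -4 * (e₁ + e₂ + e₃) := by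
    have e : C 4 * ((X - C e₁) * (X - C e₂) * (X - C e₃)) = C 4 * X ^ 3 +
        C (-4 * (e₁ + e₂ + e₃)) * X ^ 2 + C (4 * (e₁ * e₂ + e₁ * e₃ + e₂ * e₃)) * X +
        C (-4 * (e₁ * e₂ * e₃)) := by
      simp only [map_add, map_mul, map_neg]
      ring
    rw [e, twoDivision] at hc2
    simp only [coeff_add, coeff_C_mul_X_pow, coeff_C_mul_X, coeff_C] at hc2
    norm_num at hc2
    rw [← WeierstrassCurve.b₂, hc2]
    ring
  set ℓ := W.slope u u v v with hℓ
  have hslope : ℓ * (2 * v + W.a₁ * u + W.a₃) = 3 * u ^ 2 + 2 * W.a₂ * u + W.a₄ - W.a₁ * v := by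
    rw [hℓ, slope_of_Y_ne rfl hv, negY, div_mul_eq_mul_div, div_eq_iff]
    · ring
    · intro h; apply hη; linear_combination h
  set f' : K := (u - e₁) * (u - e₂) + (u - e₁) * (u - e₃) + (u - e₂) * (u - e₃) with hf'
  -- Completing the square: on `η² = 4 (x - e₁) (x - e₂) (x - e₃)` the tangent slope in `η` is `2ℓ +
  -- a₁`, and `4 (x(2R) - e₁) = (2ℓ + a₁)² + 4 (e₂ + e₃ - 2u)`.
  have hΛ : (2 * ℓ + W.a₁) * (2 * v + W.a₁ * u + W.a₃) = 2 * f' := by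
    apply mul_left_cancel₀ h2
    norm_num at hD2
    linear_combination 4 * hslope + hD2
  rw [addX]
  apply mul_left_cancel₀ h4
  linear_combination ((2 * ℓ + W.a₁) * (2 * v + W.a₁ * u + W.a₃) + 2 * f') * hΛ -
    (2 * v + W.a₁ * u + W.a₃) ^ 2 * hc2 - 4 * (e₂ + e₃ - 2 * u) * hD1

/-- A point `(x, y)` of an elliptic curve with rational `2`-torsion `(eₖ, _)` is divisible by two
if and only if all the differences `x - eₖ` are squares. -/
theorem exists_add_self_eq_some_iff [W.IsElliptic] (h2 : (2 : K) ≠ 0)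
    (hD : W.twoDivision = C 4 * ((X - C e₁) * (X - C e₂) * (X - C e₃)))
    (h12 : e₁ ≠ e₂) (h13 : e₁ ≠ e₃) (h23 : e₂ ≠ e₃) {x y : K} (hxy : W.Nonsingular x y) :
    (∃ R : W.Point, R + R = .some x y hxy) ↔
      IsSquare (x - e₁) ∧ IsSquare (x - e₂) ∧ IsSquare (x - e₃) := by
  have hD' : W.twoDivision = C 4 * ((X - C e₂) * (X - C e₁) * (X - C e₃)) := by rw [hD]; ring
  have hD'' : W.twoDivision = C 4 * ((X - C e₃) * (X - C e₁) * (X - C e₂)) := by rw [hD]; ring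
  constructor
  · rintro ⟨R, hR⟩
    cases R with
    | zero => exact absurd (hR.symm.trans (add_zero (0 : W.Point))) (Point.some_ne_zero hxy)
    | some u v huv =>
      by_cases hv : v = W.negY u v
      · rw [Point.add_self_of_Y_eq hv] at hR
        exact absurd hR.symm (Point.some_ne_zero hxy)
      · rw [Point.add_self_of_Y_ne hv] at hR
        obtain ⟨hX, -⟩ := Point.some.inj hR
        have hη : 2 * v + W.a₁ * u + W.a₃ ≠ 0 := by
          intro h
          apply hv
          rw [negY]
          linear_combination h
        have key : ∀ {e z : K}, (x - e) * (2 * v + W.a₁ * u + W.a₃) ^ 2 = z ^ 2 →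
            IsSquare (x - e) := fun {e z} h => by
          refine ⟨z / (2 * v + W.a₁ * u + W.a₃), ?_⟩
          field_simp
          linear_combination h
        rw [← hX]
        rw [← hX] at key
        exact ⟨key (addX_self_sub_mul_sq h2 hD huv.1 hv),
          key (addX_self_sub_mul_sq h2 hD' huv.1 hv), key (addX_self_sub_mul_sq h2 hD'' huv.1 hv)⟩
  · rintro ⟨⟨r₁, h₁⟩, ⟨r₂, h₂⟩, ⟨r₃, h₃⟩⟩
    have hr12 : r₁ + r₂ ≠ 0 := fun h => h12 (by linear_combination h₂ - h₁ - (r₁ - r₂) * h)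
    have hr13 : r₁ + r₃ ≠ 0 := fun h => h13 (by linear_combination h₃ - h₁ - (r₁ - r₃) * h)
    have hr23 : r₂ + r₃ ≠ 0 := fun h => h23 (by linear_combination h₃ - h₂ - (r₂ - r₃) * h)
    -- The classical halving formula, chosen so that `u - e₁ = (r₁ + r₂) (r₁ + r₃)`, and cyclically;
    -- the product of the three differences is then `w²`. The ordinate `v` solves `2v + a₁u + a₃ =
    -- 2w`.
    set u := x + r₁ * r₂ + r₁ * r₃ + r₂ * r₃ with hu
    set w := (r₁ + r₂) * (r₁ + r₃) * (r₂ + r₃) with hw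
    have hw0 : w ≠ 0 := mul_ne_zero (mul_ne_zero hr12 hr13) hr23
    set v := w - (W.a₁ * u + W.a₃) / 2 with hv
    have hη : 2 * v + W.a₁ * u + W.a₃ = 2 * w := by
      rw [hv]; field_simp; ring
    have h4 : (4 : K) ≠ 0 := by
      rw [show (4 : K) = 2 * 2 by norm_num]; exact mul_ne_zero h2 h2
    have heq : W.Equation u v := by
      have hDu := congrArg (fun p => p.eval u) hD
      simp only [twoDivision, WeierstrassCurve.b₂, WeierstrassCurve.b₄, WeierstrassCurve.b₆,
        eval_add, eval_sub, eval_mul, eval_pow, eval_C, eval_X] at hDu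
      have h5 : (u - e₁) * (u - e₂) * (u - e₃) = w ^ 2 := by
        have e1 : u - e₁ = (r₁ + r₂) * (r₁ + r₃) := by rw [hu]; linear_combination h₁
        have e2 : u - e₂ = (r₁ + r₂) * (r₂ + r₃) := by rw [hu]; linear_combination h₂
        have e3 : u - e₃ = (r₁ + r₃) * (r₂ + r₃) := by rw [hu]; linear_combination h₃
        rw [e1, e2, e3, hw]
        ring
      rw [equation_iff]
      apply mul_left_cancel₀ h4
      rw [h5] at hDu
      linear_combination (2 * v + W.a₁ * u + W.a₃ + 2 * w) * hη - hDu
    have hvn : v ≠ W.negY u v := by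
      intro h
      rw [negY] at h
      apply mul_ne_zero h2 hw0
      rw [← hη]
      linear_combination h
    have huv : W.Nonsingular u v := equation_iff_nonsingular.1 heq
    have hX : W.addX u u (W.slope u u v v) = x := by
      have h6 := addX_self_sub_mul_sq h2 hD heq hvn
      rw [hη] at h6
      have h7 : (u - e₁) ^ 2 - (e₁ - e₂) * (e₁ - e₃) = 2 * w * r₁ := by
        rw [hu, hw]
        obtain rfl : e₁ = x - r₁ * r₁ := by linear_combination -h₁
        obtain rfl : e₂ = x - r₂ * r₂ := by linear_combination -h₂
        obtain rfl : e₃ = x - r₃ * r₃ := by linear_combination -h₃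
        ring
      rw [h7] at h6
      have h8 := mul_right_cancel₀ (pow_ne_zero 2 (mul_ne_zero h2 hw0))
        (h6.trans (by ring : _ = r₁ ^ 2 * (2 * w) ^ 2))
      linear_combination h8 - h₁
    have hsum := Point.add_self_of_Y_ne (h₁ := huv) hvn
    -- Only the abscissa of the double has been matched, so it is the given point or its negative;
    -- in the latter case negate the half.
    rcases (Point.X_eq_iff (h₁ := nonsingular_add huv huv fun h => hvn h.2) (h₂ := hxy)).1 hX
      with h | h
    · exact ⟨_, hsum.trans h⟩
    · refine ⟨-.some u v huv, ?_⟩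
      rw [← neg_add, hsum, h, neg_neg]

end WeierstrassCurve.Affine

/-! ### Algebra of squares: descent values against products of pairs. -/

section Squares

variable {K : Type*} [Field K]

theorem IsSquare.of_mul_eq_sq {s N z : K} (hs : s ≠ 0) (hsq : IsSquare s) (h : s * N = z ^ 2) :
    IsSquare N := by
  obtain ⟨r, rfl⟩ := hsq
  have hr : r ≠ 0 := fun h => hs (by rw [h, zero_mul])
  refine ⟨z / r, ?_⟩
  field_simp
  linear_combination h

/-- Each value satisfies `N₁₂ · α₁α₂F₁F₂ = (α₁α₂y + y₀F₁F₂)²`, which suffices when `N₁₂ ≠ 0`. If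
`N₁₂ = 0`, the other two values are nonzero, since the differences factor into 2 × 2 minors, and
they yield the mixed pairs. -/
theorem isSquare_descent {α₁ α₂ α₃ α₄ F₁ F₂ F₃ F₄ y₀ y : K} (hα₃ : α₃ ≠ 0) (hα₄ : α₄ ≠ 0) (hy₀ : y₀ ^ 2 = α₁ * α₂ * α₃ * α₄)
    (hy : y ^ 2 = F₁ * F₂ * F₃ * F₄) (h₁₃ : α₁ * F₃ ≠ α₃ * F₁)
    (h₁₄ : α₁ * F₄ ≠ α₄ * F₁) (h₂₃ : α₂ * F₃ ≠ α₃ * F₂) (h₂₄ : α₂ * F₄ ≠ α₄ * F₂)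
    (h₃₄ : α₃ * F₄ ≠ α₄ * F₃)
    (hN₁₂ : IsSquare (α₁ * α₂ * F₃ * F₄ + α₃ * α₄ * F₁ * F₂ + 2 * y₀ * y))
    (hN₁₃ : IsSquare (α₁ * α₃ * F₂ * F₄ + α₂ * α₄ * F₁ * F₃ + 2 * y₀ * y))
    (hN₁₄ : IsSquare (α₁ * α₄ * F₂ * F₃ + α₂ * α₃ * F₁ * F₄ + 2 * y₀ * y)) :
    IsSquare (α₁ * α₂ * F₁ * F₂) := by
  set N₁₂ := α₁ * α₂ * F₃ * F₄ + α₃ * α₄ * F₁ * F₂ + 2 * y₀ * y with e₁₂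
  set N₁₃ := α₁ * α₃ * F₂ * F₄ + α₂ * α₄ * F₁ * F₃ + 2 * y₀ * y with e₁₃
  set N₁₄ := α₁ * α₄ * F₂ * F₃ + α₂ * α₃ * F₁ * F₄ + 2 * y₀ * y with e₁₄
  by_cases h0 : N₁₂ = 0
  · have h13 : N₁₃ ≠ 0 := by
      intro h
      have : (α₁ * F₄ - α₄ * F₁) * (α₂ * F₃ - α₃ * F₂) = 0 := by
        linear_combination h0 - h - e₁₂ + e₁₃
      exact mul_ne_zero (sub_ne_zero.2 h₁₄) (sub_ne_zero.2 h₂₃) this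
    have h14 : N₁₄ ≠ 0 := by
      intro h
      have : (α₁ * F₃ - α₃ * F₁) * (α₂ * F₄ - α₄ * F₂) = 0 := by
        linear_combination h0 - h - e₁₂ + e₁₄
      exact mul_ne_zero (sub_ne_zero.2 h₁₃) (sub_ne_zero.2 h₂₄) this
    have s13 : IsSquare (α₁ * α₃ * F₁ * F₃) := .of_mul_eq_sq (z := α₁ * α₃ * y + y₀ * F₁ * F₃)
      h13 hN₁₃ (by rw [e₁₃]; linear_combination -α₁ ^ 2 * α₃ ^ 2 * hy - F₁ ^ 2 * F₃ ^ 2 * hy₀)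
    have s24 : IsSquare (α₂ * α₄ * F₂ * F₄) := .of_mul_eq_sq (z := α₂ * α₄ * y + y₀ * F₂ * F₄)
      h13 hN₁₃ (by rw [e₁₃]; linear_combination -α₂ ^ 2 * α₄ ^ 2 * hy - F₂ ^ 2 * F₄ ^ 2 * hy₀)
    have s14 : IsSquare (α₁ * α₄ * F₁ * F₄) := .of_mul_eq_sq (z := α₁ * α₄ * y + y₀ * F₁ * F₄)
      h14 hN₁₄ (by rw [e₁₄]; linear_combination -α₁ ^ 2 * α₄ ^ 2 * hy - F₁ ^ 2 * F₄ ^ 2 * hy₀)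
    have s23 : IsSquare (α₂ * α₃ * F₂ * F₃) := .of_mul_eq_sq (z := α₂ * α₃ * y + y₀ * F₂ * F₃)
      h14 hN₁₄ (by rw [e₁₄]; linear_combination -α₂ ^ 2 * α₃ ^ 2 * hy - F₂ ^ 2 * F₃ ^ 2 * hy₀)
    -- The pairs 13 and 23 multiply to `α₁α₂F₁F₂ (α₃F₃)²`; if `F₃ = 0`, use index 4, where `F₄ ≠ 0`.
    by_cases hF : F₃ = 0
    · have hF₄ : F₄ ≠ 0 := by rintro rfl; exact h₃₄ (by rw [hF]; ring)
      obtain ⟨r, hr⟩ := s14.mul s24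
      exact .of_mul_eq_sq (s := (α₄ * F₄) * (α₄ * F₄)) (z := r)
        (mul_self_ne_zero.2 (mul_ne_zero hα₄ hF₄)) ⟨_, rfl⟩ (by linear_combination hr)
    · obtain ⟨r, hr⟩ := s13.mul s23
      exact .of_mul_eq_sq (s := (α₃ * F₃) * (α₃ * F₃)) (z := r)
        (mul_self_ne_zero.2 (mul_ne_zero hα₃ hF)) ⟨_, rfl⟩ (by linear_combination hr)
  · exact .of_mul_eq_sq (z := α₁ * α₂ * y + y₀ * F₁ * F₂) h0 hN₁₂
      (by rw [e₁₂]; linear_combination -α₁ ^ 2 * α₂ ^ 2 * hy - F₁ ^ 2 * F₂ ^ 2 * hy₀)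

/-- The same identity read backwards. The descent value is symmetric in the two pairs, and `F₁F₂`,
`F₃F₄` cannot both vanish, so one of the pairs can be divided out. -/
theorem isSquare_of_isSquare_pairs {α₁ α₂ α₃ α₄ F₁ F₂ F₃ F₄ y₀ y : K} (hα₁ : α₁ ≠ 0)
    (hα₂ : α₂ ≠ 0) (hα₃ : α₃ ≠ 0) (hα₄ : α₄ ≠ 0) (hy₀ : y₀ ^ 2 = α₁ * α₂ * α₃ * α₄)
    (hy : y ^ 2 = F₁ * F₂ * F₃ * F₄) (h₁₃ : α₁ * F₃ ≠ α₃ * F₁)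
    (h₁₄ : α₁ * F₄ ≠ α₄ * F₁) (h₂₃ : α₂ * F₃ ≠ α₃ * F₂) (h₂₄ : α₂ * F₄ ≠ α₄ * F₂)
    (h12 : IsSquare (α₁ * α₂ * F₁ * F₂)) (h34 : IsSquare (α₃ * α₄ * F₃ * F₄)) :
    IsSquare (α₁ * α₂ * F₃ * F₄ + α₃ * α₄ * F₁ * F₂ + 2 * y₀ * y) := by
  by_cases h : F₁ * F₂ = 0
  · have h' : F₃ * F₄ ≠ 0 := by
      intro h'
      rcases mul_eq_zero.1 h with rfl | rfl <;> rcases mul_eq_zero.1 h' with rfl | rfl <;> simp_all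
    refine .of_mul_eq_sq (z := α₃ * α₄ * y + y₀ * F₃ * F₄) ?_ h34
      (by linear_combination -α₃ ^ 2 * α₄ ^ 2 * hy - F₃ ^ 2 * F₄ ^ 2 * hy₀)
    rw [mul_assoc]
    exact mul_ne_zero (mul_ne_zero hα₃ hα₄) h'
  · refine .of_mul_eq_sq (z := α₁ * α₂ * y + y₀ * F₁ * F₂) ?_ h12
      (by linear_combination -α₁ ^ 2 * α₂ ^ 2 * hy - F₁ ^ 2 * F₂ ^ 2 * hy₀)
    rw [mul_assoc]
    exact mul_ne_zero (mul_ne_zero hα₁ hα₂) h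

/-- The value of the descent function attached to the splitting `{σ 0, σ 1}, {σ 2, σ 3}` of the
four linear forms: `α` and `F` are the values of the forms at the base point and at the variable
point, and `y₀`, `y` the corresponding ordinates. -/
def descentValue {R : Type*} [CommRing R] (σ : Equiv.Perm (Fin 4)) (α F : Fin 4 → R)
    (y₀ y : R) : R :=
  α (σ 0) * α (σ 1) * F (σ 2) * F (σ 3) + α (σ 2) * α (σ 3) * F (σ 0) * F (σ 1) + 2 * y₀ * y

theorem descentValue_isSquare_iff {α F : Fin 4 → K} {y₀ y : K} (hα : ∀ i, α i ≠ 0)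
    (hy₀ : y₀ ^ 2 = ∏ i, α i) (hy : y ^ 2 = ∏ i, F i)
    (hαF : ∀ i j, i ≠ j → α i * F j ≠ α j * F i) :
    (IsSquare (descentValue 1 α F y₀ y) ∧
      IsSquare (descentValue (Equiv.swap 1 2) α F y₀ y) ∧
      IsSquare (descentValue (Equiv.swap 1 3) α F y₀ y)) ↔
    ∀ i j, IsSquare (α i * α j * F i * F j) := by
  have e1 : descentValue 1 α F y₀ y =
    α 0 * α 1 * F 2 * F 3 + α 2 * α 3 * F 0 * F 1 + 2 * y₀ * y := rfl
  have e2 : descentValue (Equiv.swap 1 2) α F y₀ y =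
    α 0 * α 2 * F 1 * F 3 + α 1 * α 3 * F 0 * F 2 + 2 * y₀ * y := rfl
  have e3 : descentValue (Equiv.swap 1 3) α F y₀ y =
    α 0 * α 3 * F 2 * F 1 + α 2 * α 1 * F 0 * F 3 + 2 * y₀ * y := rfl
  rw [Fin.prod_univ_four] at hy₀ hy
  rw [e1, e2, e3]
  constructor
  · rintro ⟨h1, h2, h3⟩
    have key : ∀ i j k l : Fin 4, y₀ ^ 2 = α i * α j * α k * α l → y ^ 2 = F i * F j * F k * F l →
        i ≠ k → i ≠ l → j ≠ k → j ≠ l → k ≠ l →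
        IsSquare (α i * α j * F k * F l + α k * α l * F i * F j + 2 * y₀ * y) →
        IsSquare (α i * α k * F j * F l + α j * α l * F i * F k + 2 * y₀ * y) →
        IsSquare (α i * α l * F j * F k + α j * α k * F i * F l + 2 * y₀ * y) →
        IsSquare (α i * α j * F i * F j) := fun i j k l a b hik hil hjk hjl hkl c d e =>
      isSquare_descent (hα k) (hα l) a b (hαF _ _ hik) (hαF _ _ hil)
        (hαF _ _ hjk) (hαF _ _ hjl) (hαF _ _ hkl) c d e
    have k01 := key 0 1 2 3 hy₀ hy (by decide) (by decide) (by decide) (by decide)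
      (by decide) (by convert h1 using 1) (by convert h2 using 1) (by convert h3 using 1; ring)
    have k02 := key 0 2 1 3 (by rw [hy₀]; ring) (by rw [hy]; ring) (by decide) (by decide)
      (by decide) (by decide) (by decide) (by convert h2 using 1)
      (by convert h1 using 1) (by convert h3 using 1)
    have k03 := key 0 3 2 1 (by rw [hy₀]; ring) (by rw [hy]; ring) (by decide) (by decide)
      (by decide) (by decide) (by decide) (by convert h3 using 1)
      (by convert h2 using 1; ring) (by convert h1 using 1; ring)
    have k12 := key 1 2 0 3 (by rw [hy₀]; ring) (by rw [hy]; ring) (by decide) (by decide)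
      (by decide) (by decide) (by decide) (by convert h3 using 1; ring)
      (by convert h1 using 1; ring) (by convert h2 using 1; ring)
    have k13 := key 1 3 0 2 (by rw [hy₀]; ring) (by rw [hy]; ring) (by decide) (by decide)
      (by decide) (by decide) (by decide) (by convert h2 using 1; ring)
      (by convert h1 using 1; ring) (by convert h3 using 1; ring)
    have k23 := key 2 3 0 1 (by rw [hy₀]; ring) (by rw [hy]; ring) (by decide) (by decide)
      (by decide) (by decide) (by decide) (by convert h1 using 1; ring)
      (by convert h2 using 1; ring) (by convert h3 using 1; ring)
    have hlt : ∀ i j, i < j → IsSquare (α i * α j * F i * F j) := by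
      intro i j hij
      fin_cases i <;> fin_cases j <;> first | exact absurd hij (by decide) | assumption
    intro i j
    rcases lt_trichotomy i j with h | rfl | h
    · exact hlt i j h
    · exact ⟨α i * F i, by ring⟩
    · convert hlt j i h using 1
      ring
  · intro h
    have hne : ∀ i j : Fin 4, i ≠ j → α i * F j ≠ α j * F i := hαF
    refine ⟨?_, ?_, ?_⟩
    · exact isSquare_of_isSquare_pairs (hα _) (hα _) (hα _) (hα _) hy₀ hy (hne _ _ (by decide))
        (hne _ _ (by decide)) (hne _ _ (by decide)) (hne _ _ (by decide)) (h _ _) (h _ _)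
    · exact isSquare_of_isSquare_pairs (hα _) (hα _) (hα _) (hα _) (by rw [hy₀]; ring)
        (by rw [hy]; ring) (hne _ _ (by decide)) (hne _ _ (by decide)) (hne _ _ (by decide))
        (hne _ _ (by decide)) (h _ _) (h _ _)
    · exact isSquare_of_isSquare_pairs (hα _) (hα _) (hα _) (hα _) (by rw [hy₀]; ring)
        (by rw [hy]; ring) (hne _ _ (by decide)) (hne _ _ (by decide)) (hne _ _ (by decide))
        (hne _ _ (by decide)) (h _ _) (h _ _)

end Squares

/-! ### The descent functions: poles, differences and product. -/

namespace SplitQuartic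

variable {K : Type*} [Field K] (C : SplitQuartic K)

/-- The function with a double pole at the base point `(x₀, y₀)` and no other poles, attached to a
splitting of the four linear forms into two pairs. -/
def descentFun (x₀ y₀ : K) (σ : Equiv.Perm (Fin 4)) : C.FunctionField :=
  descentValue σ (fun i => algebraMap K _ (C.f i x₀)) C.fFun (algebraMap K _ y₀) C.yFun /
    (C.xFun - algebraMap K _ x₀) ^ 2

theorem fFun_eq (x₀ : K) (i : Fin 4) : C.fFun i =
    algebraMap K _ (C.a i) * (C.xFun - algebraMap K _ x₀) + algebraMap K _ (C.f i x₀) := by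
  rw [fFun, f, map_add, map_mul]
  ring

variable {C} {V : ValuationSubring C.FunctionField}

theorem isResidue_fFun (hV : V.ContainsConstants K) {x : K} (hx : V.IsResidue C.xFun x)
    (i : Fin 4) : V.IsResidue (C.fFun i) (C.f i x) :=
  ((isResidue_algebraMap _).mul hV hx).add (isResidue_algebraMap _)

theorem isResidue_descentValue {F : Type*} [Field F] [Algebra K F] {V : ValuationSubring F}
    (hV : V.ContainsConstants K) {g : Fin 4 → F} {c : Fin 4 → K} (hg : ∀ i, V.IsResidue (g i) (c i))
    {t : F} {q : K} (ht : V.IsResidue t q) (α : Fin 4 → K) (y₀ : K) (σ : Equiv.Perm (Fin 4)) :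
    V.IsResidue (descentValue σ (fun i => algebraMap K _ (α i)) g (algebraMap K _ y₀) t)
      (descentValue σ α c y₀ q) := by
  have hc := fun c : K => isResidue_algebraMap (V := V) c
  have h2 := hc 2
  rw [map_ofNat] at h2
  exact ((((((hc _).mul hV (hc _)).mul hV (hg _)).mul hV (hg _))).add
    ((((hc _).mul hV (hc _)).mul hV (hg _)).mul hV (hg _))).add ((h2.mul hV (hc _)).mul hV ht)

theorem prod_perm_four {R : Type*} [CommRing R] (σ : Equiv.Perm (Fin 4)) (g : Fin 4 → R) :
    ∏ i, g i = g (σ 0) * g (σ 1) * g (σ 2) * g (σ 3) := by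
  rw [← Equiv.prod_comp σ g, Fin.prod_univ_four]

variable {x₀ y₀ : K}

/-- At the conjugate point `(x₀, -y₀)` the fraction is `0/0`. Multiplying by the conjugate numerator
rewrites it as `((A - B) / (x - x₀))²` over a function with value `4y₀²`, so it is finite with
square value. -/
theorem exists_isResidue_descentFun_sq (σ : Equiv.Perm (Fin 4)) (h₀ : y₀ ^ 2 = ∏ i, C.f i x₀)
    (hV : V.ContainsConstants K) (h2 : (2 : K) ≠ 0) (hy₀ : y₀ ≠ 0)
    (hx : V.IsResidue C.xFun x₀) (hy : V.IsResidue C.yFun (-y₀)) :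
    ∃ c : K, V.IsResidue (C.descentFun x₀ y₀ σ) (c ^ 2) := by
  have h4 : 4 * y₀ ^ 2 ≠ 0 := by
    rw [show (4 : K) = 2 * 2 by norm_num]
    exact mul_ne_zero (mul_ne_zero h2 h2) (pow_ne_zero 2 hy₀)
  set T := C.xFun - algebraMap K _ x₀ with hT
  have hT0 : T ≠ 0 := C.xFun_sub_ne_zero x₀
  set ι := algebraMap K C.FunctionField with hι
  have hc := fun c : K => isResidue_algebraMap (V := V) c
  have hf := isResidue_fFun hV hx
  have hTr : V.IsResidue T (0 : K) := isResidue_zero_iff.2 hx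
  set α := fun i => C.f i x₀ with hα
  have hconj := isResidue_descentValue hV hf (hy.neg) α y₀ σ
  have hconj0 : descentValue σ α (fun i => C.f i x₀) y₀ (- -y₀) = 4 * y₀ ^ 2 := by
    rw [prod_perm_four σ] at h₀
    simp only [descentValue, hα]
    linear_combination -2 * h₀
  rw [hconj0] at hconj
  have hconj1 := hconj.ne_zero hV h4
  -- This is `(A - B) / (x - x₀)` expanded in `T = x - x₀`; the constant terms of `A` and `B` are
  -- both the product of the four `α i` and cancel.
  obtain ⟨r, hℓ⟩ : ∃ r : K, V.IsResidue (ι (α (σ 0)) * ι (α (σ 1)) * (ι (C.a (σ 2)) *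
      ι (C.a (σ 3)) * T + (ι (C.a (σ 2)) * ι (α (σ 3)) + ι (C.a (σ 3)) * ι (α (σ 2)))) -
      ι (α (σ 2)) * ι (α (σ 3)) * (ι (C.a (σ 0)) * ι (C.a (σ 1)) * T +
      (ι (C.a (σ 0)) * ι (α (σ 1)) + ι (C.a (σ 1)) * ι (α (σ 0))))) r :=
    ⟨_, (((hc _).mul hV (hc _)).mul hV ((((hc _).mul hV (hc _)).mul hV hTr).add
      (((hc _).mul hV (hc _)).add ((hc _).mul hV (hc _))))).sub
      (((hc _).mul hV (hc _)).mul hV ((((hc _).mul hV (hc _)).mul hV hTr).add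
      (((hc _).mul hV (hc _)).add ((hc _).mul hV (hc _)))))⟩
  have key := (hℓ.pow hV 2).div hV hconj h4
  refine ⟨r / (2 * y₀), ?_⟩
  convert key using 1
  · rw [descentFun, ← hT, div_eq_div_iff (pow_ne_zero 2 hT0) hconj1]
    have hyy := C.yFun_sq'
    have h₀' := congrArg ι h₀
    rw [prod_perm_four σ] at hyy h₀'
    simp only [map_mul, map_pow] at h₀'
    simp only [C.fFun_eq x₀, ← hT, ← hι] at hyy
    simp only [descentValue, C.fFun_eq x₀, ← hT, ← hι, hα]
    linear_combination (-4 * ι y₀ ^ 2) * hyy - 4 * ((ι (C.a (σ 0)) * T + ι (C.f (σ 0) x₀)) *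
      (ι (C.a (σ 1)) * T + ι (C.f (σ 1) x₀)) * (ι (C.a (σ 2)) * T + ι (C.f (σ 2) x₀)) *
      (ι (C.a (σ 3)) * T + ι (C.f (σ 3) x₀))) * h₀'
  · rw [div_pow]
    congr 1
    ring

/-- Divide numerator and denominator by `x²`: the numerator is homogeneous when the forms have
weight one and `y` weight two, so `F i` becomes `a i` and `y` becomes `α`. -/
theorem isResidue_descentFun_infinity (σ : Equiv.Perm (Fin 4)) (hV : V.ContainsConstants K)
    {α : K} (hx : V.IsResidue C.xFun⁻¹ (0 : K)) (hy : V.IsResidue (C.yFun / C.xFun ^ 2) α) :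
    V.IsResidue (C.descentFun x₀ y₀ σ)
      (descentValue σ (fun i => C.f i x₀) C.a y₀ α) := by
  have hx0 := C.xFun_ne_zero
  have hT0 := C.xFun_sub_ne_zero x₀
  have hc := fun c : K => isResidue_algebraMap (V := V) c
  have hf : ∀ i, V.IsResidue (C.fFun i / C.xFun) (C.a i) := fun i => by
    have := (hc (C.a i)).add ((hc (C.b i)).mul hV hx)
    convert this using 1
    · rw [fFun]; field_simp
    · ring
  have h1 := isResidue_descentValue hV hf hy (fun i => C.f i x₀) y₀ σ
  have h2 := ((hc 1).sub ((hc x₀).mul hV hx)).pow hV 2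
  have h3 := h1.div hV h2 (by simp)
  convert h3 using 1
  · rw [descentFun, map_one]
    simp only [descentValue]
    field_simp
  · simp

theorem isResidue_descentFun_affine (σ : Equiv.Perm (Fin 4)) (hV : V.ContainsConstants K)
    {x y : K} (hne : x ≠ x₀) (hx : V.IsResidue C.xFun x) (hy : V.IsResidue C.yFun y) :
    V.IsResidue (C.descentFun x₀ y₀ σ)
      (descentValue σ (fun i => C.f i x₀) (fun i => C.f i x) y₀ y / (x - x₀) ^ 2) :=
  (isResidue_descentValue hV (isResidue_fFun hV hx) hy (fun i => C.f i x₀) y₀ σ).div hV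
    ((hx.sub (isResidue_algebraMap x₀)).pow hV 2) (pow_ne_zero 2 (sub_ne_zero.2 hne))

theorem residue_yFun_eq_or_neg (h₀ : y₀ ^ 2 = ∏ i, C.f i x₀) (hV : V.ContainsConstants K)
    (hx : V.IsResidue C.xFun x₀) : V.IsResidue C.yFun y₀ ∨ V.IsResidue C.yFun (-y₀) := by
  have h1 := hx.polynomial_aeval hV C.quartic
  rw [← yFun_sq, eval_quartic, ← h₀] at h1
  apply mem_or_mem_of_mul_mem_nonunits
  rw [IsResidue, map_pow] at h1
  convert h1 using 1
  rw [map_neg]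
  ring

/-- The descent functions have no pole outside the base point. -/
theorem descentFun_mem (σ : Equiv.Perm (Fin 4)) (h₀ : y₀ ^ 2 = ∏ i, C.f i x₀) (h2 : (2 : K) ≠ 0)
    (hy₀ : y₀ ≠ 0) (hV : V.ContainsConstants K) (hne : ¬ IsCentredAt V (.affine x₀ y₀ h₀)) :
    C.descentFun x₀ y₀ σ ∈ V := by
  have hc := hV
  have h2' : (2 : C.FunctionField) ∈ V := by
    have := hc 2; rwa [map_ofNat] at this
  have hnum : ∀ {g : Fin 4 → C.FunctionField} {t : C.FunctionField}, (∀ i, g i ∈ V) → t ∈ V →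
      descentValue σ (fun i => algebraMap K _ (C.f i x₀)) g (algebraMap K _ y₀) t ∈ V :=
    fun hg ht => add_mem (add_mem (mul_mem (mul_mem (mul_mem (hc _) (hc _)) (hg _)) (hg _))
      (mul_mem (mul_mem (mul_mem (hc _) (hc _)) (hg _)) (hg _)))
      (mul_mem (mul_mem h2' (hc _)) ht)
  by_cases hx : C.xFun ∈ V
  · by_cases hT : C.xFun - algebraMap K _ x₀ ∈ V.nonunits
    · rcases residue_yFun_eq_or_neg h₀ hV hT with hy | hy
      · exact absurd ⟨hT, hy⟩ hne
      · obtain ⟨c, h⟩ := exists_isResidue_descentFun_sq σ h₀ hV h2 hy₀ hT hy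
        exact h.mem hV
    · rw [descentFun, div_eq_mul_inv, ← inv_pow]
      have hf : ∀ i, C.fFun i ∈ V := fun i => add_mem (mul_mem (hc _) hx) (hc _)
      refine mul_mem (hnum hf ?_) (pow_mem (inv_mem_of_notMem_nonunits hT) 2)
      apply mem_of_sq_mem
      rw [yFun_sq']
      exact prod_mem fun i _ => hf i
  · have hx0 := C.xFun_ne_zero
    have hT0 := C.xFun_sub_ne_zero x₀
    have hu := inv_mem_nonunits_of_notMem hx
    have hu' := mem_of_mem_nonunits hu
    have hf : ∀ i, C.fFun i / C.xFun ∈ V := fun i => by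
      have := add_mem (hc (C.a i)) (mul_mem (hc (C.b i)) hu')
      convert this using 1
      rw [fFun]; field_simp
    have hw : C.yFun / C.xFun ^ 2 ∈ V := by
      apply mem_of_sq_mem
      have e : (C.yFun / C.xFun ^ 2) ^ 2 = ∏ i, (C.fFun i / C.xFun) := by
        rw [div_pow, yFun_sq', Finset.prod_div_distrib]
        simp [← pow_mul]
      rw [e]
      exact prod_mem fun i _ => hf i
    have hd : V.IsResidue (1 - algebraMap K _ x₀ * C.xFun⁻¹) (1 : K) := by
      have := (isResidue_algebraMap (V := V) (1 : K)).sub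
        ((isResidue_algebraMap x₀).mul hV (isResidue_zero_iff.2 hu))
      simpa using this
    have hd' := (hd.inv hV one_ne_zero).mem hV
    have := mul_mem (hnum hf hw) (pow_mem hd' 2)
    convert this using 1
    rw [descentFun]
    simp only [descentValue]
    field_simp

variable {h₀ : y₀ ^ 2 = ∏ i, C.f i x₀}

theorem descentFun_num_residue (σ : Equiv.Perm (Fin 4)) (hV : V.ContainsConstants K)
    (h : IsCentredAt V (.affine x₀ y₀ h₀)) : V.IsResidue
      (descentValue σ (fun i => algebraMap K _ (C.f i x₀)) C.fFun (algebraMap K _ y₀) C.yFun)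
      (4 * y₀ ^ 2) := by
  have h1 := isResidue_descentValue hV (isResidue_fFun hV h.1) h.2 (fun i => C.f i x₀) y₀ σ
  convert h1 using 1
  rw [prod_perm_four σ] at h₀
  simp only [descentValue]
  linear_combination 2 * h₀

/-- The numerator has the nonzero value `4y₀²` at the base point, while the denominator vanishes. -/
theorem descentFun_notMem (σ : Equiv.Perm (Fin 4)) (h2 : (2 : K) ≠ 0)
    (hy₀ : y₀ ≠ 0) (hV : V.ContainsConstants K) (h : IsCentredAt V (.affine x₀ y₀ h₀)) :
    C.descentFun x₀ y₀ σ ∉ V := by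
  intro hmem
  have h1 := descentFun_num_residue σ hV h
  have hT0 := C.xFun_sub_ne_zero x₀
  have h4 : 4 * y₀ ^ 2 ≠ 0 := by
    rw [show (4 : K) = 2 * 2 by norm_num]
    exact mul_ne_zero (mul_ne_zero h2 h2) (pow_ne_zero 2 hy₀)
  refine h4 ((h1.mem_nonunits_iff hV).1 ?_)
  have hT : C.xFun - algebraMap K _ x₀ ∈ V.nonunits := h.1
  have h3 := mul_mem_nonunits hT (mul_mem (mem_of_mem_nonunits hT) hmem)
  convert h3 using 1
  rw [descentFun]
  field_simp

/-- `x - x₀` is a local parameter at the base point: `(y - y₀) / (x - x₀) = H(x) / (y + y₀)`, whose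
denominator has value `2y₀ ≠ 0`. -/
theorem div_mem_of_mem_nonunits (h2 : (2 : K) ≠ 0)
    (hy₀ : y₀ ≠ 0) (hV : V.ContainsConstants K) (h : IsCentredAt V (.affine x₀ y₀ h₀))
    {g : C.FunctionField} (hg : g ∈ V.nonunits) : g / (C.xFun - algebraMap K _ x₀) ∈ V := by
  have hT0 := C.xFun_sub_ne_zero x₀
  have hres := h.1.mvPolynomial_aeval hV h.2
  obtain ⟨n, d, hd, rfl⟩ : g ∈ C.pointLocalRing (.affine x₀ y₀ h₀) := by
    rw [h.pointLocalRing_eq h2 hV]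
    exact mem_of_mem_nonunits hg
  have hn : MvPolynomial.eval ![x₀, y₀] n = 0 := by
    by_contra hn
    exact div_ne_zero hn hd ((((hres n).div hV (hres d) hd).mem_nonunits_iff hV).1 hg)
  obtain ⟨a, b, hab⟩ := MvPolynomial.aeval_sub_eval_mem C.xFun C.yFun x₀ y₀ n
  rw [hn, map_zero, sub_zero] at hab
  obtain ⟨H, hH⟩ : X - Polynomial.C x₀ ∣ C.quartic - Polynomial.C (C.quartic.eval x₀) := by
    rw [dvd_iff_isRoot]; simp
  have hH' : C.yFun ^ 2 - algebraMap K _ (y₀ ^ 2) =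
      (C.xFun - algebraMap K _ x₀) * aeval C.xFun H := by
    rw [yFun_sq, h₀, ← eval_quartic]
    simpa using congrArg (aeval C.xFun) hH
  have hsum := h.2.add (isResidue_algebraMap y₀)
  have hy2 : y₀ + y₀ ≠ 0 := by rw [← two_mul]; exact mul_ne_zero h2 hy₀
  have hsum0 := hsum.ne_zero hV hy2
  have hyT : (C.yFun - algebraMap K _ y₀) / (C.xFun - algebraMap K _ x₀) ∈ V := by
    have := mul_mem ((h.1.polynomial_aeval hV H).mem hV) ((hsum.inv hV hy2).mem hV)
    convert this using 1
    rw [map_pow] at hH'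
    field_simp
    linear_combination hH'
  have hdinv := ((hres d).inv hV hd).mem hV
  have := mul_mem (add_mem ((hres a).mem hV) (mul_mem hyT ((hres b).mem hV))) hdinv
  convert this using 1
  rw [hab]
  field_simp

theorem descentFun_mul_sq_mem (σ : Equiv.Perm (Fin 4)) (h2 : (2 : K) ≠ 0)
    (hy₀ : y₀ ≠ 0) (hV : V.ContainsConstants K) (h : IsCentredAt V (.affine x₀ y₀ h₀))
    {g : C.FunctionField} (hg : g ∈ V.nonunits) : C.descentFun x₀ y₀ σ * g ^ 2 ∈ V := by
  have h1 := (descentFun_num_residue σ hV h).mem hV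
  have h3 := mul_mem h1 (pow_mem (div_mem_of_mem_nonunits h2 hy₀ hV h hg) 2)
  convert h3 using 1
  have hT0 := C.xFun_sub_ne_zero x₀
  rw [descentFun]
  field_simp

variable (C x₀ y₀)

theorem f_sub_mul (i j : Fin 4) : algebraMap K C.FunctionField (C.f i x₀) * C.fFun j -
    algebraMap K _ (C.f j x₀) * C.fFun i = (C.xFun - algebraMap K _ x₀) *
      algebraMap K _ (C.a j * C.b i - C.a i * C.b j) := by
  simp only [f, fFun, map_sub, map_add, map_mul]
  ring

/-- The numerators differ by `(α₀F₃ - α₃F₀) (α₁F₂ - α₂F₁)`, and each factor is a constant multiple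
of `x - x₀`. -/
theorem descentFun_sub_swap₁₂ : C.descentFun x₀ y₀ 1 - C.descentFun x₀ y₀ (Equiv.swap 1 2) =
    algebraMap K _ ((C.a 3 * C.b 0 - C.a 0 * C.b 3) * (C.a 2 * C.b 1 - C.a 1 * C.b 2)) := by
  have hT0 := C.xFun_sub_ne_zero x₀
  have e1 := C.f_sub_mul x₀ 0 3
  have e2 := C.f_sub_mul x₀ 1 2
  have hs : Equiv.swap (1 : Fin 4) 2 0 = 0 ∧ Equiv.swap (1 : Fin 4) 2 1 = 2 ∧
    Equiv.swap (1 : Fin 4) 2 2 = 1 ∧ Equiv.swap (1 : Fin 4) 2 3 = 3 := by decide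
  rw [descentFun, descentFun, ← sub_div, div_eq_iff (pow_ne_zero 2 hT0), map_mul]
  simp only [descentValue, hs, Equiv.Perm.coe_one, id]
  linear_combination (algebraMap K C.FunctionField (C.f 1 x₀) * C.fFun 2 -
    algebraMap K _ (C.f 2 x₀) * C.fFun 1) * e1 + ((C.xFun - algebraMap K _ x₀) *
      algebraMap K _ (C.a 3 * C.b 0 - C.a 0 * C.b 3)) * e2

theorem descentFun_sub_swap₁₃ : C.descentFun x₀ y₀ 1 - C.descentFun x₀ y₀ (Equiv.swap 1 3) =
    algebraMap K _ ((C.a 2 * C.b 0 - C.a 0 * C.b 2) * (C.a 3 * C.b 1 - C.a 1 * C.b 3)) := by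
  have hT0 := C.xFun_sub_ne_zero x₀
  have e1 := C.f_sub_mul x₀ 0 2
  have e2 := C.f_sub_mul x₀ 1 3
  have hs : Equiv.swap (1 : Fin 4) 3 0 = 0 ∧ Equiv.swap (1 : Fin 4) 3 1 = 3 ∧
    Equiv.swap (1 : Fin 4) 3 2 = 2 ∧ Equiv.swap (1 : Fin 4) 3 3 = 1 := by decide
  rw [descentFun, descentFun, ← sub_div, div_eq_iff (pow_ne_zero 2 hT0), map_mul]
  simp only [descentValue, hs, Equiv.Perm.coe_one, id]
  linear_combination (algebraMap K C.FunctionField (C.f 1 x₀) * C.fFun 3 -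
    algebraMap K _ (C.f 3 x₀) * C.fFun 1) * e1 + ((C.xFun - algebraMap K _ x₀) *
      algebraMap K _ (C.a 2 * C.b 0 - C.a 0 * C.b 2)) * e2

variable {x₀ y₀}

theorem exists_sq_eq_descentFun_mul (h₀ : y₀ ^ 2 = ∏ i, C.f i x₀) (hf : ∀ i, C.f i x₀ ≠ 0) :
    ∃ g : C.FunctionField, g ^ 2 = C.descentFun x₀ y₀ 1 *
      C.descentFun x₀ y₀ (Equiv.swap 1 2) * C.descentFun x₀ y₀ (Equiv.swap 1 3) := by
  have hT0 := C.xFun_sub_ne_zero x₀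
  have hy := C.yFun_ne_zero
  have hF := C.fFun_ne_zero
  set ι := algebraMap K C.FunctionField with hι
  have hα : ∀ i, ι (C.f i x₀) ≠ 0 := fun i => (_root_.map_ne_zero _).2 (hf i)
  have hy₀ : ι y₀ ≠ 0 := (_root_.map_ne_zero _).2 (by
    rintro rfl
    rw [zero_pow two_ne_zero] at h₀
    exact Finset.prod_ne_zero_iff.2 (fun i _ => hf i) h₀.symm)
  have hyy := C.yFun_sq'
  have h₀' := congrArg ι h₀
  rw [Fin.prod_univ_four] at hyy h₀'
  simp only [map_mul, map_pow] at h₀'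
  have hsq : ∀ i j k l : Fin 4, ι y₀ ^ 2 = ι (C.f i x₀) * ι (C.f j x₀) * ι (C.f k x₀) *
      ι (C.f l x₀) → C.yFun ^ 2 = C.fFun i * C.fFun j * C.fFun k * C.fFun l →
      ι (C.f i x₀) * ι (C.f j x₀) * C.fFun k * C.fFun l + ι (C.f k x₀) * ι (C.f l x₀) *
        C.fFun i * C.fFun j + 2 * ι y₀ * C.yFun =
      (ι (C.f i x₀) * ι (C.f j x₀) * C.yFun + ι y₀ * C.fFun i * C.fFun j) ^ 2 /
        (ι (C.f i x₀) * ι (C.f j x₀) * C.fFun i * C.fFun j) := by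
    intro i j k l h1 h2
    rw [eq_div_iff (mul_ne_zero (mul_ne_zero (mul_ne_zero (hα i) (hα j)) (hF i)) (hF j))]
    linear_combination -(ι (C.f i x₀) * ι (C.f j x₀)) ^ 2 * h2 -
      (C.fFun i * C.fFun j) ^ 2 * h1
  have e1 := hsq 0 1 2 3 h₀' hyy
  have e2 := hsq 0 2 1 3 (by rw [h₀']; ring) (by rw [hyy]; ring)
  have e3 := hsq 0 3 2 1 (by rw [h₀']; ring) (by rw [hyy]; ring)
  have hs : Equiv.swap (1 : Fin 4) 2 0 = 0 ∧ Equiv.swap (1 : Fin 4) 2 1 = 2 ∧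
    Equiv.swap (1 : Fin 4) 2 2 = 1 ∧ Equiv.swap (1 : Fin 4) 2 3 = 3 := by decide
  have hs' : Equiv.swap (1 : Fin 4) 3 0 = 0 ∧ Equiv.swap (1 : Fin 4) 3 1 = 3 ∧
    Equiv.swap (1 : Fin 4) 3 2 = 2 ∧ Equiv.swap (1 : Fin 4) 3 3 = 1 := by decide
  -- All three splittings are read from the pair containing index 0, so the denominators of the
  -- squares multiply to `(α₀F₀)² ∏ αᵢ ∏ Fᵢ = (α₀F₀y₀y)²`.
  refine ⟨(ι (C.f 0 x₀) * ι (C.f 1 x₀) * C.yFun + ι y₀ * C.fFun 0 * C.fFun 1) *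
    (ι (C.f 0 x₀) * ι (C.f 2 x₀) * C.yFun + ι y₀ * C.fFun 0 * C.fFun 2) *
    (ι (C.f 0 x₀) * ι (C.f 3 x₀) * C.yFun + ι y₀ * C.fFun 0 * C.fFun 3) /
    (ι (C.f 0 x₀) * ι y₀ * C.fFun 0 * C.yFun * (C.xFun - ι x₀) ^ 3), ?_⟩
  simp only [descentFun, descentValue, hs, hs', Equiv.Perm.coe_one, id, ← hι]
  rw [e1, e2, e3, div_pow, div_div, div_div, div_div, div_mul_div_comm, div_mul_div_comm]
  congr 1
  · ring
  · simp only [mul_pow]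
    rw [h₀', hyy]
    ring

end SplitQuartic

theorem ValuationSubring.IsRational.comap {K F F' : Type*} [Field K] [Field F] [Field F']
    [Algebra K F] [Algebra K F'] {V : ValuationSubring F'} (hV : V.IsRational K)
    (f : F →ₐ[K] F') : (V.comap (f : F →+* F')).IsRational K := by
  refine ⟨hV.constants.comap f, fun g hg => ?_⟩
  obtain ⟨c, hc⟩ := hV.exists_residue _ (mem_comap.1 hg)
  exact ⟨c, (V.isResidue_comap f).2 hc⟩

/-! ### Transport of points and descent functions to the elliptic curve. -/

namespace SplitQuartic

variable {K : Type*} [Field K] {C : SplitQuartic K} {W : WeierstrassCurve.Affine K}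

/-- The place of the function field of `W` corresponding to a place of the function field of `C`. -/
def BirationalIso.pullback (φ : C.BirationalIso W) (V : ValuationSubring C.FunctionField) :
    ValuationSubring W.FunctionField :=
  V.comap ((φ : W.FunctionField →ₐ[K] C.FunctionField) : W.FunctionField →+* C.FunctionField)

namespace BirationalIso

variable (φ : C.BirationalIso W) {V : ValuationSubring C.FunctionField}

theorem mem_pullback {g : W.FunctionField} : g ∈ φ.pullback V ↔ φ g ∈ V := mem_comap

theorem mem_nonunits_pullback {g : W.FunctionField} :
    g ∈ (φ.pullback V).nonunits ↔ φ g ∈ V.nonunits := mem_nonunits_comap _ _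

theorem isResidue_pullback {g : W.FunctionField} {c : K} :
    (φ.pullback V).IsResidue g c ↔ V.IsResidue (φ g) c := isResidue_comap _ _

theorem constants_pullback (hV : V.ContainsConstants K) :
    (φ.pullback V).ContainsConstants K := hV.comap _

/-- The local ring at `Q` is the valuation ring `V` itself, so matching local rings amounts to
matching places. -/
theorem mapsTo_iff (h2 : (2 : K) ≠ 0) (hV : V.ContainsConstants K) {Q : C.Point}
    (hQ : IsCentredAt V Q) {P : W.Point} :
    φ.MapsTo Q P ↔ WeierstrassCurve.Affine.IsCentredAt (φ.pullback V) P := by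
  rw [MapsTo, hQ.pointLocalRing_eq h2 hV]
  constructor
  · intro h
    obtain ⟨V', hV', hP⟩ := WeierstrassCurve.Affine.exists_isCentredAt P
    rw [hP.pointLocalRing_eq hV'] at h
    have : φ.pullback V = V' := by
      ext g
      rw [mem_pullback, ← SetLike.mem_coe, ← h, φ.injective.mem_set_image, SetLike.mem_coe]
    rwa [this]
  · intro h
    rw [h.pointLocalRing_eq (φ.constants_pullback hV)]
    ext g
    constructor
    · rintro ⟨g, hg, rfl⟩
      exact φ.mem_pullback.1 hg
    · intro hg
      exact ⟨φ.symm g, φ.mem_pullback.2 (by rwa [φ.apply_symm_apply]), φ.apply_symm_apply g⟩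

theorem exists_mapsTo [W.IsElliptic] (h2 : (2 : K) ≠ 0) (Q : C.Point) :
    ∃ P : W.Point, φ.MapsTo Q P := by
  obtain ⟨V, hV, hQ⟩ := exists_isCentredAt Q
  obtain ⟨P, hP⟩ := WeierstrassCurve.Affine.exists_point_of_isRational
    ((hQ.isRational h2 hV).comap (φ : W.FunctionField →ₐ[K] C.FunctionField))
  exact ⟨P, (φ.mapsTo_iff h2 hV hQ).2 hP⟩

theorem exists_mapsTo' (h2 : (2 : K) ≠ 0) (P : W.Point) : ∃ Q : C.Point, φ.MapsTo Q P := by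
  obtain ⟨V', hV', hP⟩ := WeierstrassCurve.Affine.exists_isCentredAt P
  have hV := (hP.isRational hV').comap (φ.symm : C.FunctionField →ₐ[K] W.FunctionField)
  obtain ⟨Q, hQ⟩ := exists_point_of_isRational hV
  refine ⟨Q, (φ.mapsTo_iff h2 hV.constants hQ).2 ?_⟩
  convert hP using 1
  ext g
  rw [mem_pullback, mem_comap]
  simp

variable {φ}

theorem MapsTo.unique (h2 : (2 : K) ≠ 0) {Q : C.Point} {P P' : W.Point} (h : φ.MapsTo Q P)
    (h' : φ.MapsTo Q P') : P = P' := by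
  obtain ⟨V, hV, hQ⟩ := exists_isCentredAt Q
  exact ((φ.mapsTo_iff h2 hV hQ).1 h).unique (φ.constants_pullback hV)
    ((φ.mapsTo_iff h2 hV hQ).1 h')

theorem MapsTo.injective (h2 : (2 : K) ≠ 0) {Q Q' : C.Point} {P : W.Point} (h : φ.MapsTo Q P)
    (h' : φ.MapsTo Q' P) : Q = Q' := by
  obtain ⟨V, hV, hQ⟩ := exists_isCentredAt Q
  obtain ⟨V', hV', hQ'⟩ := exists_isCentredAt Q'
  have h3 : C.pointLocalRing Q = C.pointLocalRing Q' := Eq.trans (Eq.symm h) h'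
  rw [hQ.pointLocalRing_eq h2 hV, hQ'.pointLocalRing_eq h2 hV'] at h3
  obtain rfl := SetLike.coe_injective h3
  exact hQ.unique hV hQ'

/-- Each rational point has a unique image, and each point of `W` has a preimage, so halving can be
done on `W`. -/
theorem mem_doubles_iff [DecidableEq K] [W.IsElliptic] (h2 : (2 : K) ≠ 0) {Q : C.Point} {P : W.Point}
    (h : φ.MapsTo Q P) : Q ∈ φ.doubles ↔ ∃ R : W.Point, R + R = P := by
  constructor
  · rintro ⟨R, P₁, P₂, h₁, h₂, h₃⟩
    obtain rfl := h₁.unique h2 h₂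
    exact ⟨P₁, h₃.unique h2 h⟩
  · rintro ⟨R, rfl⟩
    obtain ⟨S, hS⟩ := φ.exists_mapsTo' h2 R
    exact ⟨S, R, R, hS, hS, h⟩

variable {x₀ y₀ : K} {h₀ : y₀ ^ 2 = ∏ i, C.f i x₀}

/-- Under an isomorphism sending the base point to the origin, each descent function becomes an
affine linear function of the Weierstrass coordinate `x`. -/
theorem MapsTo.descentFun_eq [W.IsElliptic] (h2 : (2 : K) ≠ 0) (hy₀ : y₀ ≠ 0)
    (hφ : φ.MapsTo (.affine x₀ y₀ h₀) 0) (σ : Equiv.Perm (Fin 4)) :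
    ∃ c d : K, c ≠ 0 ∧ C.descentFun x₀ y₀ σ =
      φ (algebraMap K _ c * W.xFun + algebraMap K _ d) := by
  obtain ⟨V, hV, hQ⟩ := exists_isCentredAt (.affine x₀ y₀ h₀ : C.Point)
  have hO := (φ.mapsTo_iff h2 hV hQ).1 hφ
  have hreg : W.IsRegular (φ.symm (C.descentFun x₀ y₀ σ)) := by
    intro V' hV' hx
    have hV₁ := hV'.comap (φ.symm : C.FunctionField →ₐ[K] W.FunctionField)
    refine mem_comap.1 (descentFun_mem σ h₀ h2 hy₀ hV₁ fun hc => ?_)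
    have hO' := (φ.mapsTo_iff h2 hV₁ hc).1 hφ
    refine hO'.xFun_notMem (φ.constants_pullback hV₁) ?_
    rw [mem_pullback, mem_comap]
    simpa using hx
  obtain ⟨c, d, hcd⟩ := hreg.exists_eq_linear h2 (φ.constants_pullback hV) hO (by
    rw [mem_pullback, map_mul, map_pow, φ.apply_symm_apply]
    exact descentFun_mul_sq_mem σ h2 hy₀ hV hQ
      (φ.mem_nonunits_pullback.1 (isResidue_zero_iff.1 hO.1)))
  have hcd' : C.descentFun x₀ y₀ σ = φ (algebraMap K _ c * W.xFun + algebraMap K _ d) := by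
    rw [← hcd, φ.apply_symm_apply]
  refine ⟨c, d, ?_, hcd'⟩
  rintro rfl
  refine descentFun_notMem σ h2 hy₀ hV hQ ?_
  rw [hcd', map_zero, zero_mul, zero_add, φ.commutes]
  exact hV d

/-- The three descent functions are `c (x - eₖ)` with `c` a square, where the `eₖ` are the abscissae
of the points of order two. -/
theorem MapsTo.exists_descentFun_eq [W.IsElliptic] (h2 : (2 : K) ≠ 0) (hf : ∀ i, C.f i x₀ ≠ 0)
    (hφ : φ.MapsTo (.affine x₀ y₀ h₀) 0) : ∃ c e₁ e₂ e₃ : K, c ≠ 0 ∧ IsSquare c ∧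
      e₁ ≠ e₂ ∧ e₁ ≠ e₃ ∧ e₂ ≠ e₃ ∧
      W.twoDivision = Polynomial.C 4 *
        ((X - Polynomial.C e₁) * (X - Polynomial.C e₂) * (X - Polynomial.C e₃)) ∧
      C.descentFun x₀ y₀ 1 = φ (algebraMap K _ c * (W.xFun - algebraMap K _ e₁)) ∧
      C.descentFun x₀ y₀ (Equiv.swap 1 2) = φ (algebraMap K _ c * (W.xFun - algebraMap K _ e₂)) ∧
      C.descentFun x₀ y₀ (Equiv.swap 1 3) =
        φ (algebraMap K _ c * (W.xFun - algebraMap K _ e₃)) := by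
  have hy₀ : y₀ ≠ 0 := by
    rintro rfl
    rw [zero_pow two_ne_zero] at h₀
    exact Finset.prod_ne_zero_iff.2 (fun i _ => hf i) h₀.symm
  obtain ⟨c, d, hc, h1⟩ := hφ.descentFun_eq h2 hy₀ 1
  have hs12 := C.descentFun_sub_swap₁₂ x₀ y₀
  have hs13 := C.descentFun_sub_swap₁₃ x₀ y₀
  have hsm : ∀ i j, i ≠ j → C.a i * C.b j - C.a j * C.b i ≠ 0 := fun i j h =>
    sub_ne_zero.2 (C.smooth i j h)
  -- The constant differences of the descent functions. By the Plücker relation `δ₃ - δ₂` is again a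
  -- product of two minors, so smoothness makes the three roots distinct.
  set δ₂ := (C.a 3 * C.b 0 - C.a 0 * C.b 3) * (C.a 2 * C.b 1 - C.a 1 * C.b 2) with hδ₂
  set δ₃ := (C.a 2 * C.b 0 - C.a 0 * C.b 2) * (C.a 3 * C.b 1 - C.a 1 * C.b 3) with hδ₃
  have hδ₂0 : δ₂ ≠ 0 := mul_ne_zero (hsm _ _ (by decide)) (hsm _ _ (by decide))
  have hδ₃0 : δ₃ ≠ 0 := mul_ne_zero (hsm _ _ (by decide)) (hsm _ _ (by decide))
  have hδ₂₃ : δ₃ ≠ δ₂ := by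
    rw [← sub_ne_zero]
    have : δ₃ - δ₂ = (C.a 1 * C.b 0 - C.a 0 * C.b 1) * (C.a 3 * C.b 2 - C.a 2 * C.b 3) := by
      rw [hδ₂, hδ₃]; ring
    rw [this]
    exact mul_ne_zero (hsm _ _ (by decide)) (hsm _ _ (by decide))
  have hι : ∀ a : K, φ (algebraMap K _ a) = algebraMap K _ a := φ.commutes
  have hc' : algebraMap K C.FunctionField c ≠ 0 := (_root_.map_ne_zero _).2 hc
  have e1 : C.descentFun x₀ y₀ 1 =
      φ (algebraMap K _ c * (W.xFun - algebraMap K _ (-d / c))) := by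
    rw [h1]
    simp only [map_add, map_mul, map_sub, hι, map_div₀, map_neg]
    field_simp
    ring
  have e2 : C.descentFun x₀ y₀ (Equiv.swap 1 2) =
      φ (algebraMap K _ c * (W.xFun - algebraMap K _ ((δ₂ - d) / c))) := by
    rw [← sub_eq_iff_eq_add'.2 (sub_eq_iff_eq_add.1 hs12), h1]
    simp only [map_add, map_mul, map_sub, hι, map_div₀]
    field_simp
    ring
  have e3 : C.descentFun x₀ y₀ (Equiv.swap 1 3) =
      φ (algebraMap K _ c * (W.xFun - algebraMap K _ ((δ₃ - d) / c))) := by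
    rw [← sub_eq_iff_eq_add'.2 (sub_eq_iff_eq_add.1 hs13), h1]
    simp only [map_add, map_mul, map_sub, hι, map_div₀]
    field_simp
    ring
  obtain ⟨g, hg⟩ := C.exists_sq_eq_descentFun_mul h₀ hf
  obtain ⟨hsq, hD⟩ := WeierstrassCurve.Affine.twoDivision_eq_of_sq h2 hc (g := φ.symm g)
    (e₁ := -d / c) (e₂ := (δ₂ - d) / c) (e₃ := (δ₃ - d) / c) (by
      apply φ.injective
      rw [map_pow, φ.apply_symm_apply, hg, e1, e2, e3, ← map_mul, ← map_mul]
      congr 1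
      simp only [map_mul, map_sub, aeval_X, aeval_C, map_pow]
      ring)
  refine ⟨c, -d / c, (δ₂ - d) / c, (δ₃ - d) / c, hc, hsq, ?_, ?_, ?_, hD, e1, e2, e3⟩
  · intro h
    rw [div_left_inj' hc] at h
    exact hδ₂0 (by linear_combination -h)
  · intro h
    rw [div_left_inj' hc] at h
    exact hδ₃0 (by linear_combination -h)
  · intro h
    rw [div_left_inj' hc] at h
    exact hδ₂₃ (by linear_combination -h)

end BirationalIso

/-! ### The criterion for divisibility by two. -/

variable {x₀ y₀ : K} {h₀ : y₀ ^ 2 = ∏ i, C.f i x₀}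

/-- Away from the base point, the values of the three descent functions are squares exactly if all
products `fᵢ(x₀) fⱼ(x₀) fᵢ fⱼ` are. -/
theorem IsCentredAt.isSquare_residue_iff {V : ValuationSubring C.FunctionField}
    (h2 : (2 : K) ≠ 0) (hf : ∀ i, C.f i x₀ ≠ 0)
    (hV : V.ContainsConstants K) {Q : C.Point} (hQ : IsCentredAt V Q)
    (hne : Q ≠ .affine x₀ y₀ h₀) {β : Equiv.Perm (Fin 4) → K}
    (hβ : ∀ σ ∈ ({1, Equiv.swap 1 2, Equiv.swap 1 3} : Set (Equiv.Perm (Fin 4))),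
      V.IsResidue (C.descentFun x₀ y₀ σ) (β σ)) :
    (IsSquare (β 1) ∧ IsSquare (β (Equiv.swap 1 2)) ∧ IsSquare (β (Equiv.swap 1 3))) ↔
      ∀ i j, IsSquare (C.f i x₀ * C.f j x₀ * C.fAt i Q * C.fAt j Q) := by
  have hy₀ : y₀ ≠ 0 := by
    rintro rfl
    rw [zero_pow two_ne_zero] at h₀
    exact Finset.prod_ne_zero_iff.2 (fun i _ => hf i) h₀.symm
  have hβ1 := hβ 1 (by simp)
  have hβ2 := hβ (Equiv.swap 1 2) (by simp)
  have hβ3 := hβ (Equiv.swap 1 3) (by simp)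
  have hsm : ∀ i j, i ≠ j → C.a i * C.b j - C.a j * C.b i ≠ 0 := fun i j h =>
    sub_ne_zero.2 (C.smooth i j h)
  cases Q with
  | affine x y hxy =>
    -- Only `(x₀, -y₀)` remains over `x₀`. There both sides hold: the descent functions have square
    -- values, and the products are `(fᵢ(x₀) fⱼ(x₀))²`.
    by_cases hx : x = x₀
    · subst hx
      have hy : y = -y₀ := by
        have : (y - y₀) * (y + y₀) = 0 := by linear_combination hxy - h₀
        rcases mul_eq_zero.1 this with h | h
        · obtain rfl := sub_eq_zero.1 h
          exact absurd rfl hne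
        · linear_combination h
      subst hy
      have key : ∀ σ ∈ ({1, Equiv.swap 1 2, Equiv.swap 1 3} : Set (Equiv.Perm (Fin 4))),
          IsSquare (β σ) := fun σ hσ => by
        obtain ⟨c, hc⟩ := exists_isResidue_descentFun_sq σ h₀ hV h2 hy₀ hQ.1 hQ.2
        rw [(hβ σ hσ).eq hV hc]
        exact ⟨c, sq c⟩
      refine iff_of_true ⟨key _ (by simp), key _ (by simp), key _ (by simp)⟩ fun i j => ?_
      exact ⟨C.f i x * C.f j x, by simp only [fAt]; ring⟩
    · have hx' := sub_ne_zero.2 hx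
      have hdiv : ∀ a : K, IsSquare (a / (x - x₀) ^ 2) ↔ IsSquare a := fun a =>
        ⟨fun ⟨r, hr⟩ => ⟨r * (x - x₀), by field_simp at hr; linear_combination hr⟩,
          fun ⟨r, hr⟩ => ⟨r / (x - x₀), by field_simp; linear_combination hr⟩⟩
      rw [hβ1.eq hV (isResidue_descentFun_affine 1 hV hx hQ.1 hQ.2),
        hβ2.eq hV (isResidue_descentFun_affine _ hV hx hQ.1 hQ.2),
        hβ3.eq hV (isResidue_descentFun_affine _ hV hx hQ.1 hQ.2), hdiv, hdiv, hdiv]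
      refine descentValue_isSquare_iff hf h₀ hxy fun i j hij h => ?_
      refine mul_ne_zero (hsm i j hij) hx' ?_
      simp only [f] at h
      linear_combination -h
  | infinity α hα =>
    rw [hβ1.eq hV (isResidue_descentFun_infinity 1 hV hQ.1 hQ.2),
      hβ2.eq hV (isResidue_descentFun_infinity _ hV hQ.1 hQ.2),
      hβ3.eq hV (isResidue_descentFun_infinity _ hV hQ.1 hQ.2)]
    refine descentValue_isSquare_iff hf h₀ hα fun i j hij h => ?_
    refine hsm i j hij ?_
    simp only [f] at h
    linear_combination -h

/-- Over any field of characteristic different from two, a point is divisible by two, for the group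
law with origin `(x₀, y₀)`, if and only if all `fᵢ(x₀) fⱼ(x₀) fᵢ fⱼ` are squares at it. -/
theorem mem_doubles_iff_isSquare [DecidableEq K] [W.IsElliptic] (h2 : (2 : K) ≠ 0)
    (hf : ∀ i, C.f i x₀ ≠ 0) {φ : C.BirationalIso W} (hφ : φ.MapsTo (.affine x₀ y₀ h₀) 0)
    (Q : C.Point) : Q ∈ φ.doubles ↔
      ∀ i j, IsSquare (C.f i x₀ * C.f j x₀ * C.fAt i Q * C.fAt j Q) := by
  obtain ⟨P, hP⟩ := φ.exists_mapsTo h2 Q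
  rw [BirationalIso.mem_doubles_iff h2 hP]
  cases P with
  | zero =>
    -- The base point is the neutral element, and its products are visibly squares; it is treated
    -- apart because the descent functions have their pole there.
    obtain rfl := hP.injective h2 hφ
    refine iff_of_true ⟨0, add_zero _⟩ fun i j => ?_
    exact ⟨C.f i x₀ * C.f j x₀, by simp only [fAt]; ring⟩
  | some ξ η hξ =>
    have hne : Q ≠ .affine x₀ y₀ h₀ := by
      rintro rfl
      exact WeierstrassCurve.Affine.Point.some_ne_zero hξ (hP.unique h2 hφ)
    obtain ⟨V, hV, hQ⟩ := exists_isCentredAt Q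
    obtain ⟨c, e₁, e₂, e₃, hc, ⟨r, hr⟩, h12, h13, h23, hD, g1, g2, g3⟩ :=
      hφ.exists_descentFun_eq h2 hf
    have hx := (φ.isResidue_pullback).1 ((φ.mapsTo_iff h2 hV hQ).1 hP).1
    have hres : ∀ e : K, V.IsResidue (φ (algebraMap K _ c * (W.xFun - algebraMap K _ e)))
        (c * (ξ - e)) := fun e => by
      have := (isResidue_algebraMap (V := V) c).mul hV (hx.sub (isResidue_algebraMap e))
      simpa using this
    -- Here it matters that `c` is a square: the values `c (ξ - eₖ)` of the descent functions can
    -- replace the `ξ - eₖ` of the 2-descent criterion.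
    have hsq : ∀ a : K, IsSquare (c * a) ↔ IsSquare a := fun a => by
      have hr0 : r ≠ 0 := by rintro rfl; exact hc (by rw [hr, zero_mul])
      rw [hr]
      exact ⟨fun ⟨s, hs⟩ => ⟨s / r, by field_simp; linear_combination hs⟩,
        fun ⟨s, hs⟩ => ⟨r * s, by rw [hs]; ring⟩⟩
    rw [WeierstrassCurve.Affine.exists_add_self_eq_some_iff h2 hD h12 h13 h23 hξ, ← hsq (ξ - e₁),
      ← hsq (ξ - e₂), ← hsq (ξ - e₃)]
    classical
    have hn1 : Equiv.swap (1 : Fin 4) 2 ≠ 1 := by decide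
    have hn2 : Equiv.swap (1 : Fin 4) 3 ≠ 1 := by decide
    have hn3 : Equiv.swap (1 : Fin 4) 3 ≠ Equiv.swap 1 2 := by decide
    have key := hQ.isSquare_residue_iff h2 hf hV hne
      (β := fun σ => if σ = 1 then c * (ξ - e₁) else if σ = Equiv.swap 1 2 then c * (ξ - e₂)
        else c * (ξ - e₃)) (by
        rintro σ (rfl | rfl | rfl)
        · rw [g1, if_pos rfl]; exact hres _
        · rw [g2, if_neg hn1, if_pos rfl]; exact hres _
        · rw [g3, if_neg hn2, if_neg hn3]; exact hres _)
    rwa [if_pos rfl, if_neg hn1, if_pos rfl, if_neg hn2, if_neg hn3] at key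

end SplitQuartic

end

theorem theorem3p3 (C : SplitQuartic ℚ)
    (x₀ y₀ : ℚ) (h₀ : y₀ ^ 2 = ∏ i, C.f i x₀) (hx₀ : ∀ i, x₀ ≠ -C.b i / C.a i)
    (E : WeierstrassCurve.Affine ℚ) [E.IsElliptic]
    (φ : C.BirationalIso E) (hφ : φ.MapsTo (.affine x₀ y₀ h₀) 0)
    (Q : C.Point) :
    Q ∈ φ.doubles ↔
      ∀ i j : Fin 4, IsSquare (C.f i x₀ * C.f j x₀ * C.fAt i Q * C.fAt j Q) := by
  refine SplitQuartic.mem_doubles_iff_isSquare two_ne_zero (fun i hi => hx₀ i ?_) hφ Q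
  rw [eq_div_iff (C.a_ne_zero i)]
  rw [SplitQuartic.f] at hi
  linear_combination hi
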